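/- Let $\mathbf K=(K,+,\cdot,0,1)$ be a semiring such that the free semigroup $\{a,b\}^+$ on two generators embeds into the multiplicative monoid $(K,\cdot,1)$, i.e. there is an injective map $\varphi:\{a,b\}^+\to K$ with $\varphi(uv)=\varphi(u)\varphi(v)$ for all $u,v$. A matrix $X\in K^{n\times n}$ ($n>0$) is *synchronizing* if there is an index $i$ such that $X_{j,k}\neq 0$ if and only if $k=i$, and all entries of column $i$ are equal. A finite family $M_1,\dots,M_k\in K^{n\times n}$ is *synchronizable* if some product $M_{i_1}\cdots M_{i_t}$ with $t>0$ is synchronizing. The problem $\mathbf K$-$\mathbf{Sync}$ asks, given $n>0$ and a finite family $M_1,\dots,M_k\in K^{n\times n}$, whether the family is synchronizable. The entries of the input matrices are given by names in a partial numbering $\nu$ of $K$ (a partial map from $\mathbb N$ to $K$; $c$ is a name of $x$ if $\nu(c)=x$) in which multiplication is computable, that is, some partial recursive function maps each pair of names to a name of the product, and in which $0$, $\varphi(a)$ and $\varphi(b)$ have names. Then, for every such numbering $\nu$, the problem $\mathbf K$-$\mathbf{Sync}$ is undecidable: no algorithm halts with the correct answer on all descriptions of instances. This holds even when the instances are restricted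 to the families of transition matrices of deterministic $\mathbf K$-weighted automata with two states over an alphabet of size $8$ (eight $2\times 2$ matrices). Here a $\mathbf K$-weighted automaton consists of an initial vector $\alpha\in K^n$, transition matrices $M_a\in K^{n\times n}$ ($a$ in the alphabet) and a final vector $\beta\in K^n$, and it is *deterministic* if $\alpha$ has exactly one nonzero entry and every row of every $M_a$ has exactly one nonzero entry. -/

import Mathlib

namespace WeightedSync

/-- An `n`-state automaton over the alphabet `A` with weights in the semiring `K`: an initial
vector, a transition matrix for each letter, and a final vector. -/
structure WeightedAutomaton (K : Type*) (A : Type*) (n : ℕ) where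
  init : Fin n → K
  trans : A → Matrix (Fin n) (Fin n) K
  final : Fin n → K

/-- A weighted automaton is partial if every row of every transition matrix has at most one nonzero
entry, and the initial vector has exactly one nonzero entry. -/
def WeightedAutomaton.IsPartial {K A : Type*} [Zero K] {n : ℕ}
    (M : WeightedAutomaton K A n) : Prop :=
  (∀ a p q q', M.trans a p q ≠ 0 → M.trans a p q' ≠ 0 → q = q') ∧ ∃! p, M.init p ≠ 0

/-- A weighted automaton is deterministic if it is partial and every row of every transition matrix
has exactly one nonzero entry. -/
def WeightedAutomaton.IsDeterministic {K A : Type*} [Zero K] {n : ℕ}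
    (M : WeightedAutomaton K A n) : Prop :=
  M.IsPartial ∧ ∀ a p, ∃! q, M.trans a p q ≠ 0

/-- A square matrix is synchronizing if for some index `i` its nonzero entries are exactly those of
column `i` (it is location synchronizing), and moreover all entries of column `i` are equal. -/
def IsSynchronizing {K : Type*} [Zero K] {n : ℕ} (X : Matrix (Fin n) (Fin n) K) : Prop :=
  ∃ i, (∀ j k, X j k ≠ 0 ↔ k = i) ∧ ∀ j j', X j i = X j' i

/-- A family of square matrices is synchronizable if some nonempty product of its members is
synchronizing. -/
def Synchronizable {K A : Type*} [Semiring K] {n : ℕ}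
    (M : A → Matrix (Fin n) (Fin n) K) : Prop :=
  ∃ w : List A, w ≠ [] ∧ IsSynchronizing (w.map M).prod

/-! Elements of a semiring are handed to an algorithm through a partial numbering `ν : ℕ →. K`:
the number `c` is a name of the element `x` when `x ∈ ν c`. Elements may have many names or none,
and the set of names need not be decidable. -/

/-- Multiplication is computable on names: some partial recursive function maps every pair of names
to a name of the product. -/
def MulComputable {K : Type*} [Mul K] (ν : ℕ →. K) : Prop :=
  ∃ m : ℕ → ℕ →. ℕ, Partrec₂ m ∧
    ∀ c d x y, x ∈ ν c → y ∈ ν d → ∃ e ∈ m c d, x * y ∈ ν e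

/-- The nested list `l` (a list of matrices, each given as the list of its rows) describes the
family `M`: the entries of `l` are names of the entries of the matrices of `M`. -/
def Describes {K : Type*} (ν : ℕ →. K) (l : List (List (List ℕ))) {k n : ℕ}
    (M : Fin k → Matrix (Fin n) (Fin n) K) : Prop :=
  ∃ c : Fin k → Fin n → Fin n → ℕ,
    l = List.ofFn (fun i => List.ofFn (fun p => List.ofFn (fun q => c i p q))) ∧
    ∀ i p q, M i p q ∈ ν (c i p q)

/-- The synchronizability problem over `K` is decidable on the class `C` of instances: some
algorithm, given any description of a finite family of `n × n` matrices, `n > 0`, that belongs to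
`C`, halts and tells correctly whether the family is synchronizable. Nothing is asked of the
algorithm on other inputs. -/
def SyncDecidableOn {K : Type*} [Semiring K] (ν : ℕ →. K)
    (C : ∀ k n : ℕ, (Fin k → Matrix (Fin n) (Fin n) K) → Prop) : Prop :=
  ∃ f : List (List (List ℕ)) →. Bool, Partrec f ∧
    ∀ (k n : ℕ) (M : Fin k → Matrix (Fin n) (Fin n) K), 0 < n → C k n M →
      ∀ l, Describes ν l M → ∃ b ∈ f l, (b = true ↔ Synchronizable M)

/-- The class of all instances. -/
def AllInstances (K : Type*) (k n : ℕ) (_M : Fin k → Matrix (Fin n) (Fin n) K) : Prop :=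
  True

/-- The class of the families of transition matrices of deterministic weighted automata with `s`
states over an alphabet of `r` letters. -/
def DeterministicInstances (K : Type*) [Zero K] (r s : ℕ) (k n : ℕ)
    (M : Fin k → Matrix (Fin n) (Fin n) K) : Prop :=
  k = r ∧ n = s ∧ ∃ A : WeightedAutomaton K (Fin k) n, A.IsDeterministic ∧ A.trans = M

end WeightedSync

/-! The undecidability is proved by a chain of reductions from the halting problem. At its end, only
one entry of one of the eight `2 × 2` matrices depends on the input, and this entry is the image of
a word `x vⁿ u`.

*Matrices.* A deterministic `2 × 2` matrix over the image of the free semigroup sends each state to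
a state and collects a word. Seven diagonal matrices carry the seven pairs of a correspondence
problem, and one matrix, the reset, sends both states to state `0` and carries a last pair. A
product is synchronizing only if it contains a reset, and then, by cancelling what follows the first
reset, only if the two words collected before coincide (`synchronizable_letterMatrix_iff`). Names of
the entries can be computed by multiplying names, so that an algorithm for synchronizability would
decide the correspondence problem in which the last pair is always the last one used
(`SyncDecidableOn.computablePred`).

*Seven pairs.* This correspondence problem has to simulate a computation whose input enters the last
pair only. The computation is a tag system: a move removes `β` letters from the front of a queue and
appends a word that is determined by the first of them. It has three letters, and each letter is
coded with `β - 1` fillers behind it. For each letter there is one rule for a letter that is read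
and one rule for a letter that is skipped. The word appended by the former lacks the fillers of its
last letter, and the latter appends a single filler; this forces every letter read to be followed by
`β - 1` letters skipped. A seventh rule removes the queue that is left when the tag system halts (`tagSolvable_iff`, `exists_correspondence_not_computablePred`).

*Three letters.* A tag system manages with three letters if the alphabet is encoded in positions
modulo `β`. One letter produces a block of length divisible by `β`, which has a different word
written along each residue class of its indices. Since only every `β`-th letter of the queue is
read, the position of the block modulo `β` selects the word that is read. Another letter serves to
shift positions; the third letter produces it once, and it produces `β` copies of itself, which
shifts nothing else (`eval_dom_of_tagSolvable`, `tagSolvable_of_reaches`). What such a system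
simulates directly is a queue machine whose state is a residue to which every letter adds a constant
(`exists_markMachine`). Such a machine simulates two counters
(`exists_phaseQueue_of_counterMachine`), and two counters simulate a Turing machine with an
undecidable halting problem by holding the two halves of its tape as numbers
(`exists_counterMachine_not_computablePred`). The input of the Turing machine determines the
initial value `n` of a counter, which becomes the exponent of `vⁿ`. -/

namespace WeightedSync

open StateTransition Turing

/-! ### Simulations between transition systems -/

/-- If every step of `f₁` is matched by at least one step of `f₂`, then `f₁` halts wherever a
matching configuration of `f₂` does. In contrast to `StateTransition.Respects` nothing is asked
when `f₁` halts. -/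
theorem eval_dom_of_simulates {σ₁ σ₂ : Type*} {f₁ : σ₁ → Option σ₁} {f₂ : σ₂ → Option σ₂}
    {tr : σ₁ → σ₂ → Prop}
    (H : ∀ a₁ a₂ b₁, tr a₁ a₂ → f₁ a₁ = some b₁ → ∃ b₂, tr b₁ b₂ ∧ Reaches₁ f₂ a₂ b₂)
    {a₁ : σ₁} {a₂ : σ₂} (h : tr a₁ a₂) (hd : (eval f₂ a₂).Dom) : (eval f₁ a₁).Dom := by
  obtain ⟨b, hb⟩ := Part.dom_iff_mem.1 hd
  have key : ∀ a', Reaches f₂ a₂ a' → ∀ a₁, tr a₁ a' → (eval f₁ a₁).Dom := by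
    refine evalInduction (C := fun a₂ => ∀ a', Reaches f₂ a₂ a' → ∀ a₁, tr a₁ a' →
      (eval f₁ a₁).Dom) hb ?_
    intro a₂ _ IH a' ha' a₁ h₁
    rcases Relation.ReflTransGen.cases_head ha' with rfl | ⟨c, hc, hca'⟩
    · rcases e : f₁ a₁ with _ | b₁
      · exact Part.dom_iff_mem.2 ⟨a₁, mem_eval.2 ⟨.refl, e⟩⟩
      · obtain ⟨b₂, hb₂, hr⟩ := H _ _ _ h₁ e
        obtain ⟨c, hc, hcb⟩ := Relation.TransGen.head'_iff.1 hr
        rw [reaches_eval (Relation.ReflTransGen.single e)]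
        exact IH c hc b₂ hcb b₁ hb₂
    · exact IH c hc a' hca' a₁ h₁
  exact key a₂ .refl a₁ h

/-! ### Machines with two counters -/

/-- One instruction of a two-counter machine in base `k`, acting on an active counter `n` and a
passive counter `m`. If `div` holds then `n` is divided by `k`, otherwise it is kept; `m` becomes
`mul * m + add`; the control state becomes `next (n % k)`; and the counters change roles. -/
structure CounterOp (C : Type*) where
  div : Bool
  mul : ℕ
  add : ℕ
  next : ℕ → C

/-- A machine with two counters and control states `C`; it halts at the states without an
instruction. -/
structure CounterMachine (C : Type*) where
  base : ℕ
  op : C → Option (CounterOp C)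

/-- One step of a two-counter machine on (control state, active counter, passive counter). -/
def CounterMachine.step {C : Type*} (M : CounterMachine C) : C × ℕ × ℕ → Option (C × ℕ × ℕ)
  | (c, n, m) => (M.op c).map fun o =>
      (o.next (n % M.base), o.mul * m + o.add, if o.div then n / M.base else n)

/-! ### From Turing machines to two counters -/

/-- The number `n` represents the half-tape `L`: its digits in base `k` are the codes of the symbols
of `L`, the symbol next to the head being the last digit. -/
def HalfTape {Γ : Type*} [Inhabited Γ] (k : ℕ) (enc : Γ → ℕ) (L : ListBlank Γ) (n : ℕ) : Prop :=
  ∃ l : List Γ, L = ListBlank.mk l ∧ n = Nat.ofDigits k (l.map enc)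

section HalfTape

variable {Γ : Type*} [Inhabited Γ] {k : ℕ} {enc : Γ → ℕ}

theorem HalfTape.cons {L : ListBlank Γ} {n : ℕ} (h : HalfTape k enc L n) (a : Γ) :
    HalfTape k enc (L.cons a) (k * n + enc a) := by
  obtain ⟨l, rfl, rfl⟩ := h
  refine ⟨a :: l, by simp, ?_⟩
  simp [Nat.ofDigits_cons, add_comm]

theorem HalfTape.head (h0 : enc default = 0) (hk : ∀ a, enc a < k) {L : ListBlank Γ} {n : ℕ}
    (h : HalfTape k enc L n) : n % k = enc L.head := by
  obtain ⟨l, rfl, rfl⟩ := h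
  cases l with
  | nil => simp [h0]
  | cons a l => simp [Nat.ofDigits_cons, Nat.mod_eq_of_lt (hk a)]

theorem HalfTape.tail (hk : ∀ a, enc a < k) {L : ListBlank Γ} {n : ℕ}
    (h : HalfTape k enc L n) : HalfTape k enc L.tail (n / k) := by
  obtain ⟨l, rfl, rfl⟩ := h
  cases l with
  | nil => exact ⟨[], by simp, by simp⟩
  | cons a l =>
    refine ⟨l, by simp, ?_⟩
    have hk0 : 0 < k := (Nat.zero_le _).trans_lt (hk a)
    simp [Nat.ofDigits_cons, Nat.add_mul_div_left _ _ hk0, Nat.div_eq_of_lt (hk a)]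

end HalfTape

/-- The other direction. -/
def otherDir : Dir → Dir
  | .left => .right
  | .right => .left

/-- The two-counter machine that simulates a Turing machine whose half-tapes are read as numbers in
base `k`. The control state holds the label, the scanned symbol, and the side of the tape that is
stored in the active counter. Labels outside the finite set `S` are sent to it by `ρ`. -/
def counterOfTM0 {Γ Λ S : Type*} [Inhabited Λ] (M : TM0.Machine Γ Λ) (k : ℕ)
    (enc : Γ → ℕ) (dec : ℕ → Γ) (ι : S → Λ) (ρ : Λ → S) : CounterMachine (S × Γ × Dir) where
  base := k
  op := fun (q, a, d) => (M (ι q) a).map fun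
    | (q', .write b) => ⟨false, 1, 0, fun _ => (ρ q', b, otherDir d)⟩
    | (q', .move d') =>
      if d' = d then ⟨true, k, enc a, fun r => (ρ q', dec r, otherDir d)⟩
      else ⟨false, 1, 0, fun _ => (q, a, otherDir d)⟩

/-- The part of the tape on the given side of the head. -/
def tapeSide {Γ : Type*} [Inhabited Γ] (T : Tape Γ) : Dir → ListBlank Γ
  | .left => T.left
  | .right => T.right

theorem counterOfTM0_respects {Γ Λ S : Type*} [Inhabited Γ] [Inhabited Λ] (M : TM0.Machine Γ Λ)
    {k : ℕ} {enc : Γ → ℕ} {dec : ℕ → Γ} (h0 : enc default = 0) (hk : ∀ a, enc a < k)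
    (hdec : ∀ a, dec (enc a) = a) {ι : S → Λ} {ρ : Λ → S}
    (hρ : ∀ q a q' s, (q', s) ∈ M (ι q) a → ι (ρ q') = q') :
    Respects (TM0.step M) (counterOfTM0 M k enc dec ι ρ).step
      (fun X Y => X.q = ι Y.1.1 ∧ X.Tape.head = Y.1.2.1 ∧
        HalfTape k enc (tapeSide X.Tape Y.1.2.2) Y.2.1 ∧
        HalfTape k enc (tapeSide X.Tape (otherDir Y.1.2.2)) Y.2.2) := by
  rintro ⟨q, T⟩ ⟨⟨q₁, a, d⟩, n, m⟩ ⟨h1, h2, h3, h4⟩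
  simp only at h1 h2 h3 h4
  subst h1 h2
  rcases e : M (ι q₁) T.head with _ | ⟨q', s⟩
  · simp [TM0.step, CounterMachine.step, counterOfTM0, e]
  · have hq' := hρ _ _ _ _ e
    cases s with
    | write b =>
      simp only [TM0.step, e, Option.map_some]
      refine ⟨_, ?_, .single (by simp [CounterMachine.step, counterOfTM0, e]; rfl)⟩
      cases d <;> simp_all [Tape.write, tapeSide, otherDir]
    | move d' =>
      -- A move towards the side stored in the active counter; the other moves are preceded by an
      -- instruction that only exchanges the counters.
      have key : ∀ n m, HalfTape k enc (tapeSide T d') n →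
          HalfTape k enc (tapeSide T (otherDir d')) m →
          ∃ Y, (T.move d').head = Y.1.2.1 ∧ q' = ι Y.1.1 ∧
            HalfTape k enc (tapeSide (T.move d') Y.1.2.2) Y.2.1 ∧
            HalfTape k enc (tapeSide (T.move d') (otherDir Y.1.2.2)) Y.2.2 ∧
            Y ∈ (counterOfTM0 M k enc dec ι ρ).step ((q₁, T.head, d'), n, m) := by
        intro n m hn hm
        refine ⟨((ρ q', dec (n % k), otherDir d'), k * m + enc T.head, n / k), ?_, hq'.symm,
          ?_, ?_, ?_⟩
        · rw [hn.head h0 hk, hdec]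
          cases d' <;> rfl
        · cases d' <;> exact hm.cons _
        · cases d' <;> exact hn.tail hk
        · simp [CounterMachine.step, counterOfTM0, e]
      simp only [TM0.step, e, Option.map_some]
      by_cases hd : d' = d
      · subst hd
        obtain ⟨Y, y1, y2, y3, y4, y5⟩ := key n m h3 h4
        exact ⟨Y, ⟨y2, y1, y3, y4⟩, .single y5⟩
      · have hd1 : d = otherDir d' := by
          revert hd; cases d <;> cases d' <;> simp [otherDir]
        have hd2 : otherDir d = d' := by
          revert hd; cases d <;> cases d' <;> simp [otherDir]
        rw [hd2] at h4
        rw [hd1] at h3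
        obtain ⟨Y, y1, y2, y3, y4, y5⟩ := key m n h4 h3
        refine ⟨Y, ⟨y2, y1, y3, y4⟩, .head (b := ((q₁, T.head, d'), m, n)) ?_ (.single y5)⟩
        simp only [CounterMachine.step, counterOfTM0, e, Option.map_some, if_neg hd, hd2]
        simp

/-- A Turing machine with finitely many symbols and labels is simulated by a two-counter machine:
an input with first symbol `a` becomes the number in the active counter. -/
theorem exists_counterMachine_of_TM0 {Γ Λ : Type} [Inhabited Γ] [Finite Γ] [Inhabited Λ]
    (M : TM0.Machine Γ Λ) (S : Finset Λ) (hS : TM0.Supports M (S : Set Λ)) (a : Γ) :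
    ∃ (C : Type) (_ : Finite C) (N : CounterMachine C) (_ : 0 < N.base) (c : C)
      (enc : Γ → ℕ), ∀ l : List Γ,
        (eval N.step (c, Nat.ofDigits N.base (l.map enc), 0)).Dom ↔ (TM0.eval M (a :: l)).Dom := by
  classical
  have := Fintype.ofFinite Γ
  obtain ⟨e, he⟩ : ∃ e : Γ ≃ Fin (Fintype.card Γ), (e default : ℕ) = 0 := by
    have hpos : 0 < Fintype.card Γ := Fintype.card_pos
    refine ⟨(Fintype.equivFin Γ).trans (Equiv.swap (Fintype.equivFin Γ default) ⟨0, hpos⟩), ?_⟩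
    simp
  let q₀ : S := ⟨default, hS.1⟩
  let ρ : Λ → S := fun q => if h : q ∈ S then ⟨q, h⟩ else q₀
  let enc : Γ → ℕ := fun a => e a
  let dec : ℕ → Γ := fun n => if h : n < Fintype.card Γ then e.symm ⟨n, h⟩ else default
  have : Finite Dir := .of_surjective (fun b : Bool => if b then Dir.left else Dir.right) fun d => by
    cases d
    exacts [⟨true, rfl⟩, ⟨false, rfl⟩]
  refine ⟨S × Γ × Dir, inferInstance, counterOfTM0 M (Fintype.card Γ) enc dec Subtype.val ρ,
    Fintype.card_pos, (q₀, a, .right), enc, fun l => ?_⟩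
  have hresp := counterOfTM0_respects M (k := Fintype.card Γ) (enc := enc) (dec := dec)
    (ι := Subtype.val) (ρ := ρ) he (fun a => (e a).2) (fun a => by simp [enc, dec])
    (fun q a q' s h => by simp [ρ, show q' ∈ S from hS.2 h q.2])
  refine tr_eval_dom hresp ⟨rfl, rfl, ⟨l, rfl, rfl⟩, ⟨[], rfl, rfl⟩⟩

end WeightedSync

namespace WeightedSync

open StateTransition Turing

/-! ### A two-counter machine with an undecidable halting problem -/

theorem trNat_of_ne_zero {n : ℕ} (hn : n ≠ 0) :
    PartrecToTM2.trNat n =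
      (if n % 2 = 1 then PartrecToTM2.Γ'.bit1 else PartrecToTM2.Γ'.bit0) ::
        PartrecToTM2.trNat (n / 2) := by
  have h : ∀ (b : Bool) (m : ℕ), Nat.bit b m ≠ 0 → PartrecToTM2.trNat (Nat.bit b m) =
      (if b then PartrecToTM2.Γ'.bit1 else PartrecToTM2.Γ'.bit0) :: PartrecToTM2.trNat m := by
    intro b m hbm
    unfold PartrecToTM2.trNat
    rw [← Num.ofNat'_eq (Nat.bit b m), ← Num.ofNat'_eq m, Num.ofNat'_bit]
    rcases e : Num.ofNat' m with _ | p
    · have hm : m = 0 := by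
        have := congrArg (fun x : Num => (x : ℕ)) e
        simpa [Num.ofNat'_eq] using this
      subst hm
      cases b
      · exact absurd rfl hbm
      · rfl
    · cases b <;> rfl
  have := h (n % 2 == 1) (n / 2)
  have hbit : Nat.bit (n % 2 == 1) (n / 2) = n := by
    rcases Nat.mod_two_eq_zero_or_one n with h2 | h2 <;> simp [Nat.bit, h2] <;> omega
  rw [hbit] at this
  simpa using this hn

/-- Reading the reversed binary representation of a number in another base, with arbitrary codes for
its digits, is computable. -/
theorem primrec_ofDigits_trNat (k : ℕ) (enc : PartrecToTM2.Γ' → ℕ) :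
    Primrec fun n => Nat.ofDigits k ((PartrecToTM2.trNat n).reverse.map enc) := by
  -- The most significant digit comes first, so the weight of the next digit is computed as well.
  let f : ℕ → ℕ × ℕ := fun n =>
    (Nat.ofDigits k ((PartrecToTM2.trNat n).reverse.map enc), k ^ (PartrecToTM2.trNat n).length)
  suffices h : Primrec f from Primrec.fst.comp h
  let c : ℕ → ℕ := fun n => if n % 2 = 1 then enc .bit1 else enc .bit0
  have hc : Primrec c := Primrec.ite
    (Primrec.eq.comp (Primrec.nat_mod.comp Primrec.id (Primrec.const 2)) (Primrec.const 1))
    (Primrec.const _) (Primrec.const _)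
  have hdiv : Primrec fun n : ℕ => n / 2 := Primrec.nat_div.comp Primrec.id (Primrec.const 2)
  let g : ℕ → List (ℕ × ℕ) → Option (ℕ × ℕ) := fun n s =>
    some ((s.head?.map fun p => (p.1 + p.2 * c n, k * p.2)).getD (0, 1))
  refine Primrec.nat_omega_rec' (β := ℕ) f (m := id)
    (l := fun n => if n = 0 then [] else [n / 2]) (g := g) Primrec.id ?_ ?_ ?_ ?_
  · exact Primrec.ite (Primrec.eq.comp Primrec.id (Primrec.const 0)) (Primrec.const [])
      (Primrec.list_cons.comp hdiv (Primrec.const []))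
  · refine Primrec.option_some.comp (Primrec.option_getD.comp (Primrec.option_map
      (Primrec.list_head?.comp Primrec.snd) ?_) (Primrec.const (0, 1)))
    exact Primrec.pair
      (Primrec.nat_add.comp (Primrec.fst.comp Primrec.snd)
        (Primrec.nat_mul.comp (Primrec.snd.comp Primrec.snd)
          (hc.comp (Primrec.fst.comp Primrec.fst))))
      (Primrec.nat_mul.comp (Primrec.const k) (Primrec.snd.comp Primrec.snd))
  · intro n n' hn'
    rcases eq_or_ne n 0 with rfl | hn
    · simp at hn'
    · simp only [hn, if_false, List.mem_singleton] at hn'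
      simp only [id]
      omega
  · intro n
    rcases eq_or_ne n 0 with rfl | hn
    · simp [g, f]
    · simp only [hn, if_false, List.map_cons, List.map_nil, g, f, List.head?_cons, Option.map_some,
        Option.getD_some, trNat_of_ne_zero hn, List.reverse_cons, List.map_append,
        Nat.ofDigits_append, List.length_cons, Option.some.injEq, Prod.mk.injEq]
      refine ⟨?_, by ring⟩
      simp only [Nat.ofDigits_singleton, List.length_map, List.length_reverse, c]
      split_ifs <;> rfl

/-- Every partial recursive function has a Turing machine that halts on the binary representation of
`n`, preceded by a fixed symbol, exactly when the function is defined at `n`. -/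
theorem exists_TM0_of_partrec {F : ℕ →. ℕ} (hF : Partrec F) :
    ∃ (Γ Λ : Type) (_ : Inhabited Γ) (_ : Finite Γ) (_ : Inhabited Λ) (M : TM0.Machine Γ Λ)
      (S : Finset Λ) (_ : TM0.Supports M (S : Set Λ)) (a : Γ) (g : PartrecToTM2.Γ' → Γ),
      ∀ n, (TM0.eval M (a :: (PartrecToTM2.trNat n).reverse.map g)).Dom ↔ (F n).Dom := by
  classical
  obtain ⟨c, hc⟩ := ToPartrec.Code.exists_code
    (Nat.Partrec'.of_part (f := fun v : List.Vector ℕ 1 => F v.head)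
      (hF.comp (Primrec.vector_head.to_comp)))
  let _ : Inhabited PartrecToTM2.Λ' := ⟨PartrecToTM2.trNormal c .halt⟩
  have h2 := PartrecToTM2.tr_supports c .halt
  have h1 := TM2to1.tr_supports (M := PartrecToTM2.tr) h2
  have h0 := TM1to0.tr_supports _ h1
  refine ⟨_, _, inferInstance, ?_, inferInstance, _, _, h0,
    (true, Function.update (fun _ => none) .main (some .cons)),
    fun a => (false, Function.update (fun _ => none) .main (some a)), fun n => ?_⟩
  · have : Finite PartrecToTM2.K' := .of_surjective (fun i : Fin 4 =>
      (![.main, .rev, .aux, .stack] : Fin 4 → PartrecToTM2.K') i) fun k => by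
        cases k
        exacts [⟨0, rfl⟩, ⟨1, rfl⟩, ⟨2, rfl⟩, ⟨3, rfl⟩]
    exact inferInstanceAs (Finite (Bool × (PartrecToTM2.K' → Option PartrecToTM2.Γ')))
  · have e : TM2to1.trInit (K := PartrecToTM2.K') (Γ := fun _ => PartrecToTM2.Γ') .main
        (PartrecToTM2.trList [n]) =
        (true, Function.update (fun _ => none) .main (some .cons)) ::
          (PartrecToTM2.trNat n).reverse.map
            (fun a => (false, Function.update (fun _ => none) .main (some a))) := by
      have hrev : (PartrecToTM2.trList [n]).reverse = .cons :: (PartrecToTM2.trNat n).reverse := by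
        simp [PartrecToTM2.trList]
      unfold TM2to1.trInit
      rw [hrev]
      rfl
    have hinit : TM2.init (K := PartrecToTM2.K') (Γ := fun _ => PartrecToTM2.Γ') (σ := Option _)
        .main (PartrecToTM2.trList [n]) = PartrecToTM2.init c [n] := by
      simp only [TM2.init, PartrecToTM2.init]
      congr 1
      funext k
      cases k <;> rfl
    have h3 : (eval (TM2.step PartrecToTM2.tr) (PartrecToTM2.init c [n])).Dom ↔ (F n).Dom := by
      rw [PartrecToTM2.tr_eval]
      have := hc ⟨[n], rfl⟩
      simp only at this
      rw [this]
      rfl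
    have h4 := (iff_of_eq (congrArg Part.Dom (TM1to0.tr_eval (TM2to1.tr PartrecToTM2.tr)
      (TM2to1.trInit .main (PartrecToTM2.trList [n]))))).trans
      (TM2to1.tr_eval_dom PartrecToTM2.tr .main (PartrecToTM2.trList [n]))
    rw [e] at h4
    rw [← hinit] at h3
    exact h4.trans h3

/-- There is a two-counter machine for which it is undecidable whether it halts when started with a
given active counter and an empty passive counter. -/
theorem exists_counterMachine_not_computablePred :
    ∃ (C : Type) (_ : Finite C) (N : CounterMachine C) (_ : 0 < N.base) (c : C),
      ¬ ComputablePred fun n : ℕ => (eval N.step (c, n, 0)).Dom := by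
  let F : ℕ →. ℕ := fun n => (Denumerable.ofNat Nat.Partrec.Code n).eval 0
  have hF : Partrec F := Nat.Partrec.Code.eval_part.comp (Computable.ofNat _) (Computable.const 0)
  obtain ⟨Γ, Λ, _, _, _, M, S, hS, a, g, h⟩ := exists_TM0_of_partrec hF
  obtain ⟨C, hC, N, hN, c, enc, hc⟩ := exists_counterMachine_of_TM0 M S hS a
  refine ⟨C, hC, N, hN, c, fun hdec => ComputablePred.halting_problem 0 ?_⟩
  have hR := primrec_ofDigits_trNat N.base (enc ∘ g)
  refine ComputablePred.computable_of_manyOneReducible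
    (q := fun n : ℕ => (eval N.step (c, n, 0)).Dom)
    ⟨fun x : Nat.Partrec.Code => Nat.ofDigits N.base
      ((PartrecToTM2.trNat (Encodable.encode x)).reverse.map (enc ∘ g)),
      hR.to_comp.comp Computable.encode, fun x => ?_⟩ hdec
  have := (hc ((PartrecToTM2.trNat (Encodable.encode x)).reverse.map g)).trans (h _)
  rw [List.map_map] at this
  simpa [F] using this.symm

end WeightedSync

namespace WeightedSync

open StateTransition

/-! ### Queue machines with an additive state -/

/-- A queue machine over the letters `Γ` whose state, its phase, is a residue modulo `P`.
Reading a letter `i` in phase `d` appends the word `out d i` to the queue and adds `shift i` to the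
phase. -/
structure PhaseQueue (P : ℕ) (Γ : Type*) where
  shift : Γ → ZMod P
  out : ZMod P → Γ → List Γ

namespace PhaseQueue

variable {P : ℕ} {Γ : Type*} (Q : PhaseQueue P Γ)

/-- One step of the machine on (phase, queue); it halts when the queue is empty. -/
def step : ZMod P × List Γ → Option (ZMod P × List Γ)
  | (_, []) => none
  | (d, i :: w) => some (d + Q.shift i, w ++ Q.out d i)

/-- The total shift of a word. -/
def total (u : List Γ) : ZMod P := (u.map Q.shift).sum

/-- The word that is appended while the word `u` is read from phase `d` on. -/
def outs : ZMod P → List Γ → List Γ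
  | _, [] => []
  | d, i :: u => Q.out d i ++ outs (d + Q.shift i) u

@[simp] theorem total_nil : Q.total [] = 0 := rfl

@[simp] theorem total_cons (i : Γ) (u : List Γ) : Q.total (i :: u) = Q.shift i + Q.total u := by
  simp [total]

@[simp] theorem total_append (u v : List Γ) : Q.total (u ++ v) = Q.total u + Q.total v := by
  simp [total]

@[simp] theorem total_replicate (m : ℕ) (i : Γ) : Q.total (List.replicate m i) = m * Q.shift i := by
  simp [total]

@[simp] theorem outs_nil (d : ZMod P) : Q.outs d [] = [] := rfl

theorem outs_singleton (d : ZMod P) (i : Γ) : Q.outs d [i] = Q.out d i := by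
  simp [outs]

theorem outs_append (d : ZMod P) (u v : List Γ) :
    Q.outs d (u ++ v) = Q.outs d u ++ Q.outs (d + Q.total u) v := by
  induction u generalizing d with
  | nil => simp
  | cons i u ih => simp [outs, ih, add_assoc]

theorem outs_replicate {i : Γ} (h : Q.shift i = 0) (d : ZMod P) (m : ℕ) :
    Q.outs d (List.replicate m i) = (List.replicate m (Q.out d i)).flatten := by
  induction m with
  | zero => simp
  | succ m ih => simp [List.replicate_succ, outs, h, ih]

theorem reaches_append (d : ZMod P) (u v : List Γ) :
    Reaches Q.step (d, u ++ v) (d + Q.total u, v ++ Q.outs d u) := by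
  induction u generalizing d v with
  | nil =>
    rw [total_nil, outs_nil, add_zero, List.append_nil]
    exact .refl
  | cons i u ih =>
    refine .head (b := (d + Q.shift i, u ++ (v ++ Q.out d i))) (by simp [step]) ?_
    have := ih (d + Q.shift i) (v ++ Q.out d i)
    rw [add_assoc, List.append_assoc, ← total_cons] at this
    exact this

theorem reaches₁_self (d : ZMod P) {u : List Γ} (hu : u ≠ []) :
    Reaches₁ Q.step (d, u) (d + Q.total u, Q.outs d u) := by
  obtain ⟨i, u, rfl⟩ := List.exists_cons_of_ne_nil hu
  refine .head' (b := (d + Q.shift i, u ++ Q.out d i)) (by simp [step]) ?_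
  have := Q.reaches_append (d + Q.shift i) u (Q.out d i)
  rw [add_assoc, ← total_cons] at this
  exact this

end PhaseQueue

/-! ### From two counters to a queue -/

/-- The letters of the queue machine that simulates a two-counter machine. A configuration is
written with `pas` (one for each unit of the passive counter), `sep`, `act` (one for each unit of
the active counter) and `fin`; the other letters occur in the course of an instruction. -/
inductive CounterLetter (P : ℕ)
  | pas | sep | act | fin
  | pas' | sep' | quo | fin' (p : ZMod P)
  | new | newSep

theorem finite_counterLetter (P : ℕ) [NeZero P] : Finite (CounterLetter P) := by
  refine .of_surjective (fun x : Fin 9 ⊕ ZMod P => x.elim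
    (![.pas, .sep, .act, .fin, .pas', .sep', .quo, .new, .newSep] : Fin 9 → CounterLetter P)
    .fin') fun x => ?_
  cases x with
  | pas => exact ⟨.inl 0, rfl⟩
  | sep => exact ⟨.inl 1, rfl⟩
  | act => exact ⟨.inl 2, rfl⟩
  | fin => exact ⟨.inl 3, rfl⟩
  | pas' => exact ⟨.inl 4, rfl⟩
  | sep' => exact ⟨.inl 5, rfl⟩
  | quo => exact ⟨.inl 6, rfl⟩
  | fin' p => exact ⟨.inr p, rfl⟩
  | new => exact ⟨.inl 7, rfl⟩
  | newSep => exact ⟨.inl 8, rfl⟩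

section

variable {W : ℕ} [NeZero W]

/-- The phase for the control state `c` and the remainder of `n` modulo `k`. -/
def counterPhase (k : ℕ) (c : Fin W) (n : ℕ) : ZMod (W * k) := ((c + W * n : ℕ) : ZMod (W * k))

/-- The control state stored in a phase. -/
def phaseState {k : ℕ} (p : ZMod (W * k)) : Fin W := Fin.ofNat W p.val

/-- The remainder stored in a phase. -/
def phaseRem {k : ℕ} (p : ZMod (W * k)) : ℕ := p.val / W

theorem phaseState_counterPhase (k : ℕ) (c : Fin W) (n : ℕ) :
    phaseState (counterPhase k c n) = c := by
  ext
  rw [phaseState, counterPhase, ZMod.val_natCast, Fin.val_ofNat,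
    Nat.mod_mod_of_dvd _ (Nat.dvd_mul_right _ _), Nat.add_mul_mod_self_left, Nat.mod_eq_of_lt c.2]

theorem phaseRem_counterPhase (k : ℕ) (c : Fin W) (n : ℕ) :
    phaseRem (counterPhase k c n) = n % k := by
  rw [phaseRem, counterPhase, ZMod.val_natCast, Nat.mod_mul_right_div_self,
    Nat.add_mul_div_left _ _ (NeZero.pos W), Nat.div_eq_of_lt c.2, zero_add]

/-- The queue machine that simulates the two-counter machine `N`. While the active counter is read,
the phase counts the letters `act` modulo the base; at `fin` it holds the control state and the
remainder, and the letter `fin'` remembers this phase so that its shift leads to the phase of the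
next control state after another pass. -/
def queueOfCounter (N : CounterMachine (Fin W)) :
    PhaseQueue (W * N.base) (CounterLetter (W * N.base)) where
  shift
    | .act => (W : ZMod (W * N.base))
    | .fin' p =>
      match N.op (phaseState p) with
      | none => -p
      | some o => counterPhase N.base (o.next (phaseRem p)) 0 - p
    | _ => 0
  out p
    | .pas => match N.op (phaseState p) with | none => [] | some _ => [.pas']
    | .sep => match N.op (phaseState p) with | none => [] | some _ => [.sep']
    | .act =>
      match N.op (phaseState p) with
      | none => []
      | some o => if o.div ∧ phaseRem p + 1 ≠ N.base then [] else [.quo]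
    | .fin => [.fin' p]
    | .pas' =>
      match N.op (phaseState p) with
      | none => []
      | some o => List.replicate o.mul .new
    | .sep' =>
      match N.op (phaseState p) with
      | none => []
      | some o => List.replicate o.add .new ++ [.newSep]
    | .quo => [.pas]
    | .fin' _ => match N.op (phaseState p) with | none => [] | some _ => [.sep]
    | .new => [.act]
    | .newSep => [.fin]

/-- The queue that represents the counters `n` (active) and `m` (passive). -/
def counterWord (P n m : ℕ) : List (CounterLetter P) :=
  List.replicate m .pas ++ .sep :: (List.replicate n .act ++ [.fin])

variable (N : CounterMachine (Fin W))

theorem counterPhase_add_total (c : Fin W) (n : ℕ) :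
    counterPhase N.base c 0 + (queueOfCounter N).total (List.replicate n .act) =
      counterPhase N.base c n := by
  rw [PhaseQueue.total_replicate]
  simp [queueOfCounter, counterPhase, mul_comm]

theorem outs_act_some (hk : 0 < N.base) {c : Fin W} {o : CounterOp (Fin W)} (h : N.op c = some o)
    (n : ℕ) : (queueOfCounter N).outs (counterPhase N.base c 0) (List.replicate n .act) =
      List.replicate (if o.div then n / N.base else n) .quo := by
  induction n with
  | zero => simp
  | succ n ih =>
    rw [List.replicate_succ', PhaseQueue.outs_append, ih, PhaseQueue.outs_singleton,
      counterPhase_add_total]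
    have hmod : n % N.base + 1 = N.base ↔ N.base ∣ n + 1 := by
      have h1 := Nat.mod_lt n hk
      have h2 : N.base ∣ n + 1 ↔ N.base ∣ n % N.base + 1 := by
        rw [Nat.dvd_iff_mod_eq_zero, Nat.dvd_iff_mod_eq_zero, Nat.mod_add_mod]
      rw [h2]
      exact ⟨fun h => dvd_of_eq h.symm, fun h => le_antisymm h1 (Nat.le_of_dvd (by omega) h)⟩
    simp only [queueOfCounter, phaseState_counterPhase, h, phaseRem_counterPhase]
    cases hd : o.div
    · simp [List.replicate_succ']
    · by_cases hdvd : N.base ∣ n + 1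
      · simp [hmod, hdvd, Nat.succ_div, List.replicate_succ']
      · simp [hmod, hdvd, Nat.succ_div]

theorem outs_act_none {c : Fin W} (h : N.op c = none) (n : ℕ) :
    (queueOfCounter N).outs (counterPhase N.base c 0) (List.replicate n .act) = [] := by
  induction n with
  | zero => simp
  | succ n ih =>
    rw [List.replicate_succ', PhaseQueue.outs_append, ih, PhaseQueue.outs_singleton,
      counterPhase_add_total]
    simp [queueOfCounter, phaseState_counterPhase, h]

theorem queueOfCounter_reaches₁ (hk : 0 < N.base) {c : Fin W} {o : CounterOp (Fin W)}
    (h : N.op c = some o) (n m : ℕ) :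
    Reaches₁ (queueOfCounter N).step (counterPhase N.base c 0, counterWord _ n m)
      (counterPhase N.base (o.next (n % N.base)) 0,
        counterWord _ (o.mul * m + o.add) (if o.div then n / N.base else n)) := by
  set Q := queueOfCounter N with hQ
  set p := counterPhase N.base c n with hp
  set n' := if o.div then n / N.base else n
  have hstate : N.op (phaseState p) = some o := by rw [hp, phaseState_counterPhase, h]
  have hstate0 : N.op (phaseState (counterPhase N.base c 0)) = some o := by
    rw [phaseState_counterPhase, h]
  have hrem : phaseRem p = n % N.base := by rw [hp, phaseRem_counterPhase]
  have hpas : Q.shift .pas = 0 := rfl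
  have hpas' : Q.shift .pas' = 0 := rfl
  have hquo : Q.shift .quo = 0 := rfl
  have hnew : Q.shift .new = 0 := rfl
  have hsep : Q.shift .sep = 0 := rfl
  have hsep' : Q.shift .sep' = 0 := rfl
  have hnewSep : Q.shift .newSep = 0 := rfl
  have hfin' : Q.shift (.fin' p) = counterPhase N.base (o.next (n % N.base)) 0 - p := by
    simp [hQ, queueOfCounter, hstate, hrem]
  -- The counters are read, and the phase learns the remainder.
  have h1 : Reaches₁ Q.step (counterPhase N.base c 0, counterWord _ n m)
      (p, List.replicate m .pas' ++ .sep' :: (List.replicate n' .quo ++ [.fin' p])) := by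
    have e := Q.reaches₁_self (counterPhase N.base c 0) (u := counterWord _ n m)
      (by simp [counterWord])
    have e1 : Q.out (counterPhase N.base c 0) .pas = [.pas'] := by
      simp [hQ, queueOfCounter, hstate0]
    have e2 : Q.out (counterPhase N.base c 0) .sep = [.sep'] := by
      simp [hQ, queueOfCounter, hstate0]
    have e3 : Q.out p .fin = [.fin' p] := rfl
    have e4 : Q.shift .fin = 0 := rfl
    have e5 := counterPhase_add_total N c n
    rw [← hQ, ← hp] at e5
    rw [counterWord, PhaseQueue.outs_append, Q.outs_replicate hpas, PhaseQueue.outs,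
      PhaseQueue.outs_append] at e
    have e6 : Q.total (List.replicate m .pas) = 0 := by
      rw [PhaseQueue.total_replicate, hpas, mul_zero]
    simp only [PhaseQueue.total_append, PhaseQueue.total_cons, e6, hsep, add_zero, zero_add, e4,
      PhaseQueue.total_nil] at e
    rw [e5, outs_act_some N hk h, PhaseQueue.outs_singleton, e1, e2,
      e3, List.flatten_replicate_singleton] at e
    exact e
  -- The new passive counter and the quotient are written, and the phase changes.
  have h2 : Reaches₁ Q.step
      (p, List.replicate m .pas' ++ .sep' :: (List.replicate n' .quo ++ [.fin' p]))
      (counterPhase N.base (o.next (n % N.base)) 0, (List.replicate (o.mul * m + o.add) .new ++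
        [.newSep]) ++ (List.replicate n' .pas ++ [.sep])) := by
    have e := Q.reaches₁_self p
      (u := List.replicate m .pas' ++ .sep' :: (List.replicate n' .quo ++ [.fin' p])) (by simp)
    have e1 : Q.out p .pas' = List.replicate o.mul .new := by simp [hQ, queueOfCounter, hstate]
    have e2 : Q.out p .sep' = List.replicate o.add .new ++ [.newSep] := by
      simp [hQ, queueOfCounter, hstate]
    have e3 : Q.out p .quo = [.pas] := rfl
    have e4 : Q.out p (.fin' p) = [.sep] := by simp [hQ, queueOfCounter, hstate]
    rw [PhaseQueue.outs_append, Q.outs_replicate hpas', PhaseQueue.outs,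
      PhaseQueue.outs_append, Q.outs_replicate hquo] at e
    simp only [PhaseQueue.total_append, PhaseQueue.total_cons, PhaseQueue.total_replicate,
      hpas', hsep', hquo, hfin', mul_zero, add_zero, zero_add, PhaseQueue.total_nil,
      PhaseQueue.outs_singleton, e1, e2, e3, e4, List.flatten_replicate_singleton,
      List.flatten_replicate_replicate, add_sub_cancel] at e
    rw [mul_comm o.mul, List.replicate_add]
    simpa only [List.append_assoc] using e
  -- The new counters are put into the order in which the next instruction expects them.
  have h3 : Reaches Q.step
      (counterPhase N.base (o.next (n % N.base)) 0, (List.replicate (o.mul * m + o.add) .new ++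
        [.newSep]) ++ (List.replicate n' .pas ++ [.sep]))
      (counterPhase N.base (o.next (n % N.base)) 0, counterWord _ (o.mul * m + o.add) n') := by
    have e := Q.reaches_append (counterPhase N.base (o.next (n % N.base)) 0)
      (List.replicate (o.mul * m + o.add) .new ++ [.newSep]) (List.replicate n' .pas ++ [.sep])
    have e1 (d) : Q.out d .new = [.act] := rfl
    have e2 (d) : Q.out d .newSep = [.fin] := rfl
    rw [PhaseQueue.outs_append, Q.outs_replicate hnew, PhaseQueue.outs_singleton] at e
    simp only [PhaseQueue.total_append, PhaseQueue.total_cons, PhaseQueue.total_replicate,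
      hnew, hnewSep, mul_zero, add_zero, PhaseQueue.total_nil, e1, e2,
      List.flatten_replicate_singleton] at e
    simpa only [counterWord, List.append_assoc, List.singleton_append] using e
  exact (h1.trans h2).trans_left h3

theorem queueOfCounter_reaches_nil {c : Fin W} (h : N.op c = none) (n m : ℕ) :
    Reaches (queueOfCounter N).step (counterPhase N.base c 0, counterWord _ n m) (0, []) := by
  set Q := queueOfCounter N with hQ
  set p := counterPhase N.base c n with hp
  have hstate : N.op (phaseState p) = none := by rw [hp, phaseState_counterPhase, h]
  have hstate0 : N.op (phaseState (counterPhase N.base c 0)) = none := by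
    rw [phaseState_counterPhase, h]
  have hpas : Q.shift .pas = 0 := rfl
  have hsep : Q.shift .sep = 0 := rfl
  have h1 : Reaches₁ Q.step (counterPhase N.base c 0, counterWord _ n m) (p, [.fin' p]) := by
    have e := Q.reaches₁_self (counterPhase N.base c 0) (u := counterWord _ n m)
      (by simp [counterWord])
    have e1 : Q.out (counterPhase N.base c 0) .pas = [] := by
      simp [hQ, queueOfCounter, hstate0]
    have e2 : Q.out (counterPhase N.base c 0) .sep = [] := by
      simp [hQ, queueOfCounter, hstate0]
    have e3 : Q.out p .fin = [.fin' p] := rfl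
    have e4 : Q.shift .fin = 0 := rfl
    have e5 := counterPhase_add_total N c n
    rw [← hQ, ← hp] at e5
    rw [counterWord, PhaseQueue.outs_append, Q.outs_replicate hpas, PhaseQueue.outs,
      PhaseQueue.outs_append] at e
    have e6 : Q.total (List.replicate m .pas) = 0 := by
      rw [PhaseQueue.total_replicate, hpas, mul_zero]
    simp only [PhaseQueue.total_append, PhaseQueue.total_cons, e6, hsep, add_zero, zero_add, e4,
      PhaseQueue.total_nil] at e
    rw [e5, outs_act_none N h, PhaseQueue.outs_singleton, e1, e2,
      e3] at e
    simp only [List.flatten_replicate_nil, List.nil_append] at e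
    exact e
  refine h1.to_reflTransGen.tail ?_
  simp [PhaseQueue.step, hQ, queueOfCounter, hstate]

end

/-- A two-counter machine is simulated by a queue machine with an additive state that empties its
queue in phase `0` when the two-counter machine halts. -/
theorem exists_phaseQueue_of_counterMachine {C : Type} [Finite C] (N : CounterMachine C)
    (hk : 0 < N.base) (c : C) :
    ∃ (P : ℕ) (_ : P ≠ 0) (Γ : Type) (_ : Finite Γ) (Q : PhaseQueue P Γ) (d : ZMod P)
      (x y z : Γ), ∀ n : ℕ,
        ((eval N.step (c, n, 0)).Dom → Reaches Q.step (d, x :: (List.replicate n y ++ [z])) (0, []))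
        ∧ ((eval Q.step (d, x :: (List.replicate n y ++ [z]))).Dom →
          (eval N.step (c, n, 0)).Dom) := by
  have := Fintype.ofFinite C
  let e := Fintype.equivFin C
  have : NeZero (Fintype.card C) := ⟨(Fintype.card_pos_iff.2 ⟨c⟩).ne'⟩
  -- The machine `N` with its control states renamed.
  let N' : CounterMachine (Fin (Fintype.card C)) :=
    ⟨N.base, fun i => (N.op (e.symm i)).map fun o => ⟨o.div, o.mul, o.add, fun r => e (o.next r)⟩⟩
  let f : C × ℕ × ℕ → ZMod (Fintype.card C * N.base) ×
      List (CounterLetter (Fintype.card C * N.base)) := fun x =>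
    (counterPhase N.base (e x.1) 0, counterWord _ x.2.1 x.2.2)
  have hstep : ∀ a b, N.step a = some b → Reaches₁ (queueOfCounter N').step (f a) (f b) := by
    rintro ⟨c, n, m⟩ b hb
    obtain ⟨o, ho, rfl⟩ := Option.map_eq_some_iff.1 hb
    exact queueOfCounter_reaches₁ N' hk (c := e c)
      (o := ⟨o.div, o.mul, o.add, fun r => e (o.next r)⟩) (by simp [N', ho]) n m
  have hword : ∀ n, f (c, n, 0) = (counterPhase N.base (e c) 0,
      .sep :: (List.replicate n .act ++ [.fin])) := fun n => rfl
  have hP : Fintype.card C * N.base ≠ 0 := mul_ne_zero (NeZero.ne _) hk.ne'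
  have : NeZero (Fintype.card C * N.base) := ⟨hP⟩
  refine ⟨_, hP, _, finite_counterLetter _, queueOfCounter N', counterPhase N.base (e c) 0,
    .sep, .act, .fin, fun n => ⟨fun hd => ?_, fun hd => ?_⟩⟩
  · obtain ⟨b, hb⟩ := Part.dom_iff_mem.1 hd
    obtain ⟨hr, hn⟩ := mem_eval.1 hb
    have h1 : Reaches (queueOfCounter N').step (f (c, n, 0)) (f b) :=
      Relation.ReflTransGen.lift' f (fun a b h => (hstep a b h).to_reflTransGen) _ _ hr
    refine h1.trans (queueOfCounter_reaches_nil N' (c := e b.1) ?_ _ _)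
    have : N.op b.1 = none := by simpa [CounterMachine.step] using hn
    simp [N', this]
  · exact eval_dom_of_simulates (tr := fun a b => b = f a)
      (fun a₁ a₂ b₁ h h1 => ⟨_, rfl, h ▸ hstep _ _ h1⟩) rfl hd

end WeightedSync

namespace WeightedSync

open StateTransition

/-! ### Position machines -/

/-- The positions modulo `β` at which the word `l` has a letter `true`, when the word starts at
position `f` and only the letters `false` advance the position. -/
def marks {β : ℕ} (f : ZMod β) : List Bool → List (ZMod β)
  | [] => []
  | true :: l => f :: marks f l
  | false :: l => marks (f + 1) l

/-- One step of the position machine with the table `tr`, on the queue of the marked positions and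
the position at which the next word will be written: the first mark `j` is read, and the word
`tr j` is written. -/
def markStep {β : ℕ} (tr : ZMod β → List Bool) :
    List (ZMod β) × ZMod β → Option (List (ZMod β) × ZMod β)
  | ([], _) => none
  | (j :: js, f) => some (js ++ marks f (tr j), f + (tr j).count false)

/-- The configuration of the position machine in which the word `l` has been written from position
`f` on, and nothing has been read. -/
def markInit {β : ℕ} (f : ZMod β) (l : List Bool) : List (ZMod β) × ZMod β :=
  (marks f l, f + l.count false)

section marks

variable {β : ℕ}

theorem marks_append (f : ZMod β) (u v : List Bool) :
    marks f (u ++ v) = marks f u ++ marks (f + ((u.count false : ℕ) : ZMod β)) v := by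
  induction u generalizing f with
  | nil => simp [marks]
  | cons b u ih => cases b <;> simp [marks, ih, add_comm, add_left_comm]

theorem marks_replicate_false (f : ZMod β) (n : ℕ) : marks f (List.replicate n false) = [] := by
  induction n generalizing f with
  | zero => rfl
  | succ n ih => simp [List.replicate_succ, marks, ih]

theorem markInit_replicate_append (f : ZMod β) (n : ℕ) (l : List Bool) :
    markInit f (List.replicate n false ++ l) = markInit (f + (n : ZMod β)) l := by
  simp [markInit, marks_append, marks_replicate_false, add_assoc]

end marks

/-! ### From queue machines to position machines -/

section

variable {P κ : ℕ} {Γ : Type*} (Q : PhaseQueue P Γ) (e : Γ ≃ Fin κ)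

/-- The code of a letter: its number is the position of the mark relative to the start of the code,
and the length of the code modulo `P * κ` is `κ` times the shift of the letter. -/
def letterCode (i : Γ) : List Bool :=
  List.replicate (e i) false ++
    true :: List.replicate (κ * (Q.shift i).val + (κ * P - e i)) false

/-- The position of the start of a letter that is written in phase `d`. -/
def phasePos (κ : ℕ) (d : ZMod P) : ZMod (κ * P) := (κ * d.val : ℕ)

theorem marks_letterCode (d : ZMod P) (i : Γ) :
    marks (phasePos κ d) (letterCode Q e i) = [phasePos κ d + (e i : ℕ)] := by
  simp [letterCode, marks_append, marks_replicate_false, marks]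

variable [NeZero P]

theorem phasePos_add (d t : ZMod P) :
    phasePos κ (d + t) = phasePos κ d + (κ * t.val : ℕ) := by
  rw [phasePos, phasePos, ← Nat.cast_add, ← mul_add, ZMod.val_add, ZMod.natCast_eq_natCast_iff,
    Nat.ModEq, Nat.mul_mod_mul_left, Nat.mul_mod_mul_left, Nat.mod_mod]

theorem count_letterCode (i : Γ) :
    (((letterCode Q e i).count false : ℕ) : ZMod (κ * P)) = (κ * (Q.shift i).val : ℕ) := by
  have h : (e i : ℕ) ≤ κ * P := (e i).2.le.trans (Nat.le_mul_of_pos_right _ (NeZero.pos P))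
  have : (letterCode Q e i).count false = κ * (Q.shift i).val + κ * P := by
    simp only [letterCode, List.count_append, List.count_replicate_self, List.count_cons]
    simp
    omega
  rw [this, Nat.cast_add, ZMod.natCast_self, add_zero]

theorem count_flatMap_letterCode (d : ZMod P) (w : List Γ) :
    phasePos κ d + ((w.flatMap (letterCode Q e)).count false : ℕ) = phasePos κ (d + Q.total w) := by
  induction w generalizing d with
  | nil => simp
  | cons i w ih =>
    rw [List.flatMap_cons, List.count_append, Nat.cast_add, count_letterCode, ← add_assoc,
      ← phasePos_add, ih, PhaseQueue.total_cons, add_assoc]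

variable [NeZero κ]

/-- The table of the position machine that simulates the queue machine `Q`: the position `κ * p + i`
of a mark stands for the letter number `i`, read in phase `p`. -/
def queueTable (j : ZMod (κ * P)) : List Bool :=
  (Q.out (j.val / κ : ℕ) (e.symm (Fin.ofNat κ j.val))).flatMap (letterCode Q e)

theorem queueTable_phasePos (d : ZMod P) (i : Γ) :
    queueTable Q e (phasePos κ d + (e i : ℕ)) = (Q.out d i).flatMap (letterCode Q e) := by
  have hlt : κ * d.val + e i < κ * P := by
    have h1 := (e i).2
    have h2 := ZMod.val_lt d
    nlinarith
  have hval : (phasePos κ d + (e i : ℕ)).val = κ * d.val + e i := by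
    rw [phasePos, ← Nat.cast_add, ZMod.val_natCast, Nat.mod_eq_of_lt hlt]
  have hdiv : (κ * d.val + e i) / κ = d.val := by
    rw [Nat.mul_add_div (NeZero.pos κ), Nat.div_eq_of_lt (e i).2, add_zero]
  have hmod : Fin.ofNat κ (κ * d.val + e i) = e i := by
    ext
    simp [Fin.ofNat, Nat.mod_eq_of_lt (e i).2]
  rw [queueTable, hval, hdiv, hmod, Equiv.symm_apply_apply, ZMod.natCast_zmod_val]

/-- The configuration of the position machine that represents one of the queue machine. -/
def queueInit (X : ZMod P × List Γ) : List (ZMod (κ * P)) × ZMod (κ * P) :=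
  markInit (phasePos κ X.1) (X.2.flatMap (letterCode Q e))

theorem markStep_queueInit {X Y : ZMod P × List Γ} (h : Q.step X = some Y) :
    markStep (queueTable Q e) (queueInit Q e X) = some (queueInit Q e Y) := by
  obtain ⟨d, _ | ⟨i, w⟩⟩ := X
  · simp [PhaseQueue.step] at h
  · obtain rfl : (d + Q.shift i, w ++ Q.out d i) = Y := by simpa [PhaseQueue.step] using h
    simp only [queueInit, markInit, List.flatMap_cons, marks_append, marks_letterCode,
      List.singleton_append, markStep, queueTable_phasePos, List.flatMap_append, List.count_append,
      Nat.cast_add, count_letterCode, ← add_assoc, ← phasePos_add, count_flatMap_letterCode]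

end

/-- There is a position machine for which it is undecidable whether it halts when started with a
word of the form `u vⁿ x`; where it halts it does so at position `0`. -/
theorem exists_markMachine :
    ∃ (β : ℕ) (_ : β ≠ 0) (tr : ZMod β → List Bool) (u v x : List Bool) (_ : v ≠ []) (_ : x ≠ [])
      (p : ℕ → Prop), ¬ ComputablePred p ∧ ∀ n, ∃ w, w = u ++ ((List.replicate n v).flatten ++ x) ∧
        (p n → Reaches (markStep tr) (markInit 0 w) ([], 0)) ∧
        ((eval (markStep tr) (markInit 0 w)).Dom → p n) := by
  obtain ⟨C, hC, N, hN, c, hp⟩ := exists_counterMachine_not_computablePred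
  obtain ⟨P, hP, Γ, hΓ, Q, d, x, y, z, h⟩ := exists_phaseQueue_of_counterMachine N hN c
  have := Fintype.ofFinite Γ
  have : NeZero P := ⟨hP⟩
  have : NeZero (Fintype.card Γ) := ⟨(Fintype.card_pos_iff.2 ⟨x⟩).ne'⟩
  let e := Fintype.equivFin Γ
  have hstep : ∀ X Y, Q.step X = some Y →
      Reaches₁ (markStep (queueTable Q e)) (queueInit Q e X) (queueInit Q e Y) :=
    fun X Y h => .single (markStep_queueInit Q e h)
  refine ⟨Fintype.card Γ * P, mul_ne_zero (NeZero.ne _) hP, queueTable Q e,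
    List.replicate (Fintype.card Γ * d.val) false ++ letterCode Q e x, letterCode Q e y,
    letterCode Q e z, by simp [letterCode], by simp [letterCode], _, hp, fun n => ⟨_, rfl, ?_⟩⟩
  have hinit : markInit 0 (List.replicate (Fintype.card Γ * d.val) false ++ letterCode Q e x ++
      ((List.replicate n (letterCode Q e y)).flatten ++ letterCode Q e z)) =
      queueInit Q e (d, x :: (List.replicate n y ++ [z])) := by
    rw [List.append_assoc, markInit_replicate_append, zero_add (M := ZMod _)]
    simp [queueInit, phasePos, List.flatMap_replicate]
  rw [hinit]
  refine ⟨fun hd => ?_, fun hd => (h n).2 ?_⟩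
  · have h0 : queueInit Q e ((0 : ZMod P), []) = ([], 0) := by
      simp [queueInit, phasePos, markInit, marks]
    rw [← h0]
    exact Relation.ReflTransGen.lift' (queueInit Q e)
      (fun a b h => (hstep a b h).to_reflTransGen) _ _ ((h n).1 hd)
  · exact eval_dom_of_simulates (tr := fun a b => b = queueInit Q e a)
      (fun a₁ a₂ b₁ h h1 => ⟨_, rfl, h ▸ hstep _ _ h1⟩) rfl hd

end WeightedSync

namespace WeightedSync

open StateTransition

/-! ### Tag systems with three letters -/

section

variable {β : ℕ}

/-- The word produced by a letter of the tag system, before it is expanded: the letter `none`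
produces `β` times itself, which leaves the positions of all other letters unchanged. -/
def tagItems (β : ℕ) : Option Bool → List Bool
  | none => List.replicate β false
  | some b => [b]

/-- The letters of a word that are read when every `β`-th letter is read and the word starts at the
position `d`. -/
def readLetters (d : ZMod β) : List (Option Bool) → List (Option Bool)
  | [] => []
  | x :: l => (if d = 0 then [x] else []) ++ readLetters (d + 1) l

/-- A move on the queue of the tag system: either the next `β` letters are removed and the
production of the first one is appended, or `2 * β` letters `none` are removed and `β` letters
`none` are appended. -/
inductive TagMove (β : ℕ)
  | tag (x : Option Bool) (s : List (Option Bool)) (h : s.length + 1 = β)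
  | shrink

/-- The word removed by a move. -/
def TagMove.removed : TagMove β → List (Option Bool)
  | tag x s _ => x :: s
  | shrink => List.replicate (2 * β) none

/-- The word appended by a move, before it is expanded. -/
def TagMove.items : TagMove β → List Bool
  | tag x _ _ => tagItems β x
  | shrink => List.replicate β false

theorem readLetters_append (d : ZMod β) (u v : List (Option Bool)) :
    readLetters d (u ++ v) = readLetters d u ++ readLetters (d + ((u.length : ℕ) : ZMod β)) v := by
  induction u generalizing d with
  | nil => simp [readLetters]
  | cons x u ih => simp [readLetters, ih, add_comm, add_left_comm]

theorem readLetters_replicate_none (d : ZMod β) (n : ℕ) :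
    ∃ m, readLetters d (List.replicate n none) = List.replicate m none := by
  induction n generalizing d with
  | zero => exact ⟨0, rfl⟩
  | succ n ih =>
    obtain ⟨m, hm⟩ := ih (d + 1)
    by_cases h : d = 0
    · exact ⟨m + 1, by simp [List.replicate_succ, readLetters, h, ← hm]⟩
    · exact ⟨m, by simp [List.replicate_succ, readLetters, h, ← hm]⟩

theorem readLetters_eq_nil {d : ZMod β} {s : List (Option Bool)} (h : d + (s.length : ℕ) = 0)
    (hs : s.length < β) : readLetters d s = [] := by
  induction s generalizing d with
  | nil => rfl
  | cons x s ih =>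
    have hd : d ≠ 0 := by
      rintro rfl
      rw [zero_add, ZMod.natCast_eq_zero_iff] at h
      exact absurd (Nat.le_of_dvd (by simp) h) (by omega)
    simp only [readLetters, hd, if_false, List.nil_append]
    refine ih ?_ (by simp at hs; omega)
    rw [← h]
    push_cast [List.length_cons]
    ring

theorem marks_eq_nil {d : ZMod β} {l : List Bool} (h : marks d l = []) :
    l = List.replicate l.length false := by
  induction l generalizing d with
  | nil => rfl
  | cons b l ih =>
    cases b
    · rw [List.length_cons, List.replicate_succ, ← ih h]
    · simp [marks] at h

theorem marks_eq_cons {d j : ZMod β} {l : List Bool} {js : List (ZMod β)}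
    (h : marks d l = j :: js) :
    ∃ (k : ℕ) (l' : List Bool), l = List.replicate k false ++ true :: l' ∧
      d + (k : ZMod β) = j ∧ marks (d + (k : ZMod β)) l' = js := by
  induction l generalizing d with
  | nil => simp [marks] at h
  | cons b l ih =>
    cases b
    · obtain ⟨k, l', rfl, rfl, rfl⟩ := ih h
      have e : d + ((k + 1 : ℕ) : ZMod β) = d + 1 + k := by push_cast; ring
      exact ⟨k + 1, l', rfl, e, by rw [e]⟩
    · simp only [marks, List.cons.injEq] at h
      exact ⟨0, l, rfl, by simpa using h.1, by simpa using h.2⟩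

theorem markInit_append (f : ZMod β) (u v : List Bool) :
    markInit f (u ++ v) = (marks f u ++ (markInit (f + ((u.count false : ℕ) : ZMod β)) v).1,
      (markInit (f + ((u.count false : ℕ) : ZMod β)) v).2) := by
  simp [markInit, marks_append, add_assoc]

theorem markInit_flatMap_tagItems (f : ZMod β) (l : List (Option Bool)) :
    markInit f (l.flatMap (tagItems β)) = markInit f l.reduceOption := by
  induction l generalizing f with
  | nil => rfl
  | cons x l ih =>
    cases x with
    | none =>
      rw [List.flatMap_cons, tagItems, markInit_replicate_append, ih]
      simp [List.reduceOption]
    | some b =>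
      rw [List.flatMap_cons, tagItems, List.reduceOption_cons_of_some, markInit_append, ih,
        ← markInit_append, List.singleton_append]

theorem marks_tagItems_append (f : ZMod β) (x : Option Bool) (l : List Bool) :
    marks f (tagItems β x ++ l) = marks f ([x].reduceOption ++ l) := by
  cases x with
  | none => simp [tagItems, marks_append, marks_replicate_false, List.reduceOption]
  | some b => rfl

theorem length_removed (g : TagMove β) : ((TagMove.removed g).length : ZMod β) = 0 := by
  cases g with
  | tag x s h => simp [TagMove.removed, h]
  | shrink => simp [TagMove.removed]

theorem marks_flatMap_items (f : ZMod β) (G : List (TagMove β)) :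
    marks f (G.flatMap TagMove.items) =
      marks f (readLetters (0 : ZMod β) (G.flatMap TagMove.removed)).reduceOption := by
  induction G generalizing f with
  | nil => rfl
  | cons g G ih =>
    rw [List.flatMap_cons, List.flatMap_cons, readLetters_append, List.reduceOption_append,
      length_removed, add_zero]
    cases g with
    | tag x s h =>
      have hs : readLetters (1 : ZMod β) s = [] := by
        refine readLetters_eq_nil ?_ (by omega)
        rw [add_comm, ← Nat.cast_succ, Nat.succ_eq_add_one, h, ZMod.natCast_self]
      simp only [TagMove.items, TagMove.removed, readLetters, marks_tagItems_append, if_true,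
        zero_add, hs, List.append_nil]
      rw [marks_append, marks_append, ih]
    | shrink =>
      obtain ⟨m, hm⟩ := readLetters_replicate_none (0 : ZMod β) (2 * β)
      simp only [TagMove.items, TagMove.removed, hm]
      rw [marks_append, ih]
      simp [marks_replicate_false, List.reduceOption]

variable [NeZero β] (tr : ZMod β → List Bool)

/-- A word that reads off the table `tr`: the letters at the indices congruent to `-j` modulo `β`
spell `tr j`, followed by letters `none`. Its length is a positive multiple of `β`. -/
def tagBlock : List (Option Bool) :=
  (List.range (Finset.univ.sup (fun j => (tr j).length) + 1)).flatMap fun y =>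
    (List.range β).map fun x : ℕ => (tr (-(x : ZMod β)))[y]?

/-- The word that carries the word `l` of a position machine: `true` becomes a block, in which the
position does not change modulo `β`, and `false` becomes the single letter `none`. -/
def expand (l : List Bool) : List (Option Bool) :=
  l.flatMap fun b => if b then tagBlock tr else [none]

/-- The tag system can empty its queue, in the sense that the words removed by some sequence of
moves are the initial queue followed by the words appended by these moves. -/
def TagSolvable (q : List (Option Bool)) : Prop :=
  ∃ G : List (TagMove β), G.flatMap TagMove.removed = q ++ expand tr (G.flatMap TagMove.items)

theorem expand_append (u v : List Bool) : expand tr (u ++ v) = expand tr u ++ expand tr v := by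
  simp [expand]

theorem expand_replicate_false (n : ℕ) :
    expand tr (List.replicate n false) = List.replicate n none := by
  induction n with
  | zero => rfl
  | succ n ih => simpa [expand, List.replicate_succ] using ih

theorem readLetters_map_range (d : ZMod β) (g : ℕ → Option Bool) {n : ℕ} (hn : n ≤ β) :
    readLetters d ((List.range n).map g) = if (-d).val < n then [g (-d).val] else [] := by
  induction n with
  | zero => simp [readLetters]
  | succ n ih =>
    have h : d + (n : ZMod β) = 0 ↔ (-d).val = n := by
      rw [add_comm, add_eq_zero_iff_eq_neg]
      constructor
      · intro h
        rw [← h, ZMod.val_natCast, Nat.mod_eq_of_lt hn]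
      · intro h
        rw [← h, ZMod.natCast_zmod_val]
    rw [List.range_succ, List.map_append, readLetters_append, ih (by omega)]
    simp only [List.length_map, List.length_range, List.map_cons, List.map_nil, readLetters, h,
      List.append_nil]
    split_ifs with h1 h2 h3 h4 h5 h6 <;> first | omega | simp_all

theorem readLetters_tagBlock (d : ZMod β) : (readLetters d (tagBlock tr)).reduceOption = tr d := by
  have h1 : ∀ ys : List ℕ, readLetters d (ys.flatMap fun y =>
      (List.range β).map fun x : ℕ => (tr (-(x : ZMod β)))[y]?) = ys.map fun y => (tr d)[y]? := by
    intro ys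
    induction ys with
    | nil => rfl
    | cons y ys ih =>
      rw [List.flatMap_cons, readLetters_append, readLetters_map_range _ _ le_rfl]
      simp [ZMod.val_lt, ih]
  have h2 : ∀ (l : List Bool) (n : ℕ), l.length ≤ n →
      ((List.range n).map fun y => l[y]?).reduceOption = l := by
    intro l
    induction l with
    | nil => intro n _; simp [List.reduceOption]
    | cons b l ih =>
      intro n hn
      obtain ⟨n, rfl⟩ : ∃ m, n = m + 1 := ⟨n - 1, by simp at hn; omega⟩
      rw [List.range_succ_eq_map]
      simp only [List.map_cons, List.map_map]
      have := ih n (by simpa using hn)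
      simpa [List.reduceOption, Function.comp_def] using this
  rw [tagBlock, h1]
  exact h2 _ _ (Nat.le_succ_of_le (Finset.le_sup (f := fun j => (tr j).length) (Finset.mem_univ d)))

theorem length_tagBlock : ((tagBlock tr).length : ZMod β) = 0 := by
  simp [tagBlock, List.length_flatMap]

theorem tagBlock_ne_nil : tagBlock tr ≠ [] := by
  rw [tagBlock, List.range_succ_eq_map, List.flatMap_cons]
  exact List.append_ne_nil_of_left_ne_nil (by
    simpa using NeZero.ne β) _

/-- Among the letters of an expanded word that are read there are, besides letters `none`, exactly
the words of the table for the marks of the word. -/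
theorem readLetters_expand (d : ZMod β) (l : List Bool) :
    (readLetters d (expand tr l)).reduceOption = (marks d l).flatMap tr := by
  induction l generalizing d with
  | nil => rfl
  | cons b l ih =>
    have : expand tr (b :: l) = (if b then tagBlock tr else [none]) ++ expand tr l := rfl
    rw [this, readLetters_append, List.reduceOption_append]
    cases b
    · have := ih (d + 1)
      by_cases hd : d = 0 <;> simpa [marks, readLetters, hd, List.reduceOption] using this
    · simp [marks, readLetters_tagBlock, length_tagBlock, ih]

/-- If the tag system can empty its queue then the position machine halts: the marks of the word
that passes through the queue are a finite run of the position machine. -/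
theorem eval_dom_of_tagSolvable {l : List Bool} (h : TagSolvable tr (expand tr l)) :
    (eval (markStep tr) (markInit 0 l)).Dom := by
  obtain ⟨G, hG⟩ := h
  rw [← expand_append] at hG
  have key : ∀ (J js : List (ZMod β)) (f : ZMod β), J = js ++ marks f (J.flatMap tr) →
      (eval (markStep tr) (js, f)).Dom := by
    intro J
    induction J with
    | nil =>
      intro js f hJ
      obtain rfl : js = [] := (List.append_eq_nil_iff.1 hJ.symm).1
      exact Part.dom_iff_mem.2 ⟨_, mem_eval.2 ⟨.refl, rfl⟩⟩
    | cons j J ih =>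
      intro js f hJ
      cases js with
      | nil => exact Part.dom_iff_mem.2 ⟨_, mem_eval.2 ⟨.refl, rfl⟩⟩
      | cons j' js =>
        simp only [List.cons_append, List.cons.injEq, List.flatMap_cons, marks_append] at hJ
        obtain ⟨rfl, hJ⟩ := hJ
        rw [reaches_eval (f := markStep tr)
          (b := (js ++ marks f (tr j), f + ((tr j).count false : ℕ)))
          (.single rfl)]
        exact ih _ _ (by rw [List.append_assoc]; exact hJ)
  refine key (marks 0 (l ++ G.flatMap TagMove.items)) _ _ ?_
  conv_lhs => rw [marks_append, marks_flatMap_items, hG, readLetters_expand]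

/-! #### Emptying the queue -/

/-- The tag system can empty the queue `q` when it is still going to skip the letters at the
positions from `d` up to the next multiple of `β`. -/
def TagSolvableFrom (d : ZMod β) (q : List (Option Bool)) : Prop :=
  ∃ (s : List (Option Bool)) (G : List (TagMove β)), d + (s.length : ℕ) = 0 ∧ s.length < β ∧
    s ++ G.flatMap TagMove.removed = q ++ expand tr (G.flatMap TagMove.items)

theorem TagSolvableFrom.append {d : ZMod β} {u q : List (Option Bool)}
    (h : TagSolvableFrom tr (d + (u.length : ℕ))
      (q ++ expand tr ((readLetters d u).flatMap (tagItems β)))) :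
    TagSolvableFrom tr d (u ++ q) := by
  induction u generalizing d q with
  | nil => simpa [readLetters, expand] using h
  | cons x u ih =>
    have h1 : TagSolvableFrom tr (d + 1)
        (u ++ (q ++ expand tr (if d = 0 then tagItems β x else []))) := by
      apply ih
      have e : d + (((x :: u).length : ℕ) : ZMod β) = d + 1 + ((u.length : ℕ) : ZMod β) := by
        push_cast [List.length_cons]
        ring
      rw [e] at h
      rw [List.append_assoc, ← expand_append]
      convert h using 3
      by_cases hd : d = 0 <;> simp [readLetters, hd]
    obtain ⟨s, G, hs, hsβ, hG⟩ := h1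
    by_cases hd : d = 0
    · subst hd
      have hs1 : s.length + 1 = β := by
        have h2 : β ∣ s.length + 1 := by
          rw [← ZMod.natCast_eq_zero_iff, ← hs]
          push_cast
          ring
        exact le_antisymm hsβ (Nat.le_of_dvd (by simp) h2)
      refine ⟨[], .tag x s hs1 :: G, by simp, NeZero.pos β, ?_⟩
      simp only [if_true] at hG
      simp [TagMove.removed, TagMove.items, expand_append, hG]
    · refine ⟨x :: s, G, by rw [← hs]; push_cast [List.length_cons]; ring, ?_, ?_⟩
      · refine lt_of_le_of_ne hsβ fun h2 => hd ?_
        have h2 : s.length + 1 = β := h2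
        rw [add_assoc, ← Nat.cast_one, ← Nat.cast_add, add_comm 1, h2, ZMod.natCast_self,
          add_zero] at hs
        exact hs
      · simpa [hd, expand] using hG

theorem TagSolvableFrom.replicate_none {d : ZMod β} {n : ℕ} (h : d + n = 0) :
    TagSolvableFrom tr d (List.replicate n none) := by
  -- After the skipped letters only multiples of `β` are left; each shrinking removes `β` of them.
  refine ⟨List.replicate (n % β) none, List.replicate (n / β) .shrink, by simpa using h,
    by simpa using Nat.mod_lt n (NeZero.pos β), ?_⟩
  have : ∀ m, expand tr ((List.replicate m (TagMove.shrink (β := β))).flatMap TagMove.items) =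
      List.replicate (m * β) none := by
    intro m
    rw [← expand_replicate_false tr]
    simp [List.flatMap_replicate, TagMove.items]
  rw [this]
  simp only [List.flatMap_replicate, TagMove.removed, List.flatten_replicate_replicate,
    List.replicate_append_replicate]
  congr 1
  have := Nat.mod_add_div n β
  nlinarith

theorem tagSolvableFrom_of_reaches {X : List (ZMod β) × ZMod β}
    (h : Reaches (markStep tr) X ([], 0)) (d : ZMod β) (l : List Bool) (hl : markInit d l = X) :
    TagSolvableFrom tr d (expand tr l) := by
  induction h using Relation.ReflTransGen.head_induction_on generalizing d l with
  | refl =>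
    obtain ⟨h1, h2⟩ := Prod.mk.inj hl
    rw [marks_eq_nil h1, expand_replicate_false]
    refine .replicate_none tr ?_
    rw [marks_eq_nil h1, List.count_replicate_self] at h2
    exact h2
  | @head X Y h _ ih =>
    obtain ⟨_ | ⟨j, js⟩, f⟩ := X
    · simp [markStep] at h
    obtain ⟨h1, h2⟩ := Prod.mk.inj hl
    obtain ⟨k, l', rfl, rfl, rfl⟩ := marks_eq_cons h1
    -- The letters up to the end of the first block pass through the queue.
    have e : expand tr (List.replicate k false ++ true :: l') =
        (List.replicate k none ++ tagBlock tr) ++ expand tr l' := by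
      rw [expand_append, expand_replicate_false]
      simp [expand]
    rw [e]
    refine .append tr ?_
    rw [← expand_append]
    obtain ⟨m, hm⟩ := readLetters_replicate_none d k
    have hred : (readLetters d (List.replicate k none ++ tagBlock tr)).reduceOption =
        tr (d + (k : ZMod β)) := by
      rw [readLetters_append, List.reduceOption_append, hm, List.length_replicate,
        readLetters_tagBlock]
      simp [List.reduceOption]
    have hlen : d + (((List.replicate k none ++ tagBlock tr).length : ℕ) : ZMod β) =
        d + (k : ZMod β) := by
      rw [List.length_append, Nat.cast_add, length_tagBlock, add_zero, List.length_replicate]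
    rw [hlen]
    apply ih
    have hY : (marks (d + (k : ZMod β)) l' ++ marks f (tr (d + k)),
        f + (((tr (d + k)).count false : ℕ) : ZMod β)) = Y := by
      simpa [markStep] using h
    have hf : d + (k : ZMod β) + ((l'.count false : ℕ) : ZMod β) = f := by
      rw [← h2]
      simp [add_assoc]
    rw [← hY, markInit_append, hf, markInit_flatMap_tagItems, hred]
    rfl

/-- If the position machine halts at position `0` then the tag system can empty its queue. -/
theorem tagSolvable_of_reaches {l : List Bool} (h : Reaches (markStep tr) (markInit 0 l) ([], 0)) :
    TagSolvable tr (expand tr l) := by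
  obtain ⟨s, G, hs, hsβ, hG⟩ := tagSolvableFrom_of_reaches tr h 0 l rfl
  rw [zero_add, ZMod.natCast_eq_zero_iff] at hs
  obtain rfl : s = [] := List.eq_nil_of_length_eq_zero (Nat.eq_zero_of_dvd_of_lt hs hsβ)
  exact ⟨G, hG⟩

end

end WeightedSync

namespace WeightedSync

/-! ### A correspondence problem with seven pairs -/

/-- The code of a word of the tag system: each letter is followed by `β - 1` fillers `none`. -/
def fill (β : ℕ) (q : List (Option Bool)) : List (Option (Option Bool)) :=
  q.flatMap fun x => some x :: List.replicate (β - 1) none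

theorem fill_cons (β : ℕ) (x : Option Bool) (q : List (Option Bool)) :
    fill β (x :: q) = some x :: (List.replicate (β - 1) none ++ fill β q) := by
  simp [fill]

theorem fill_append (β : ℕ) (u v : List (Option Bool)) :
    fill β (u ++ v) = fill β u ++ fill β v := by
  simp [fill]

theorem fill_append_eq_fill {β : ℕ} {w z : List (Option Bool)} {r : List (Option (Option Bool))}
    (h : fill β w ++ r = fill β z) : ∃ z', z = w ++ z' ∧ r = fill β z' := by
  induction w generalizing z with
  | nil => exact ⟨z, rfl, h⟩
  | cons x w ih =>
    cases z with
    | nil => simp [fill] at h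
    | cons y z =>
      simp only [fill_cons, List.cons_append, List.append_assoc, List.cons.injEq,
        Option.some.injEq, List.append_cancel_left_eq] at h
      obtain ⟨rfl, h⟩ := h
      obtain ⟨z', rfl, rfl⟩ := ih h
      exact ⟨z', rfl, rfl⟩

theorem fill_injective (β : ℕ) : Function.Injective (fill β) := by
  intro w z h
  obtain ⟨z', rfl, h'⟩ := fill_append_eq_fill (r := []) (by simpa using h)
  cases z' with
  | nil => simp
  | cons => simp [fill] at h'

/-- The rules of the correspondence problem for a tag system: reading a letter that is skipped,
reading a letter that produces, and shrinking a run of letters `none`. -/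
inductive TagRule
  | skip (x : Option Bool)
  | produce (x : Option Bool)
  | shrink
  deriving Fintype

theorem card_tagRule : Fintype.card TagRule = 7 := rfl

section

variable {β : ℕ}

/-- The upper word of a pair: what the rule removes from the queue. -/
def TagRule.upper (β : ℕ) : TagRule → List (Option (Option Bool))
  | skip x => fill β [x]
  | produce x => fill β [x]
  | shrink => fill β (List.replicate (2 * β) none)

/-- The rules that carry out a move of the tag system. -/
def TagMove.rules : TagMove β → List TagRule
  | tag x s _ => .produce x :: s.map .skip
  | shrink => [.shrink]

theorem upper_flatMap_rules (G : List (TagMove β)) :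
    (G.flatMap TagMove.rules).flatMap (TagRule.upper β) = fill β (G.flatMap TagMove.removed) := by
  induction G with
  | nil => rfl
  | cons g G ih =>
    rw [List.flatMap_cons, List.flatMap_append, ih, List.flatMap_cons, fill_append]
    congr 1
    cases g with
    | tag x s h =>
      simp only [TagMove.rules, TagMove.removed, List.flatMap_cons, List.flatMap_map]
      rw [← List.singleton_append, fill_append]
      simp [TagRule.upper, fill]
    | shrink => simp [TagMove.rules, TagMove.removed, TagRule.upper]

variable [NeZero β] (tr : ZMod β → List Bool)

/-- The lower word of a pair: what the rule appends to the queue. The last letter of a production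
lacks its fillers. They are supplied by the `β - 1` letters that are skipped next, which makes the
order of the rules visible in the word. -/
def TagRule.lower : TagRule → List (Option (Option Bool))
  | skip _ => [none]
  | produce x =>
    fill β (expand tr (tagItems β x)).dropLast ++
      ((expand tr (tagItems β x)).getLast?.map some).toList
  | shrink => fill β (List.replicate β none)

theorem expand_tagItems_ne_nil (x : Option Bool) : expand tr (tagItems β x) ≠ [] := by
  cases x with
  | none => simp [tagItems, expand_replicate_false, NeZero.ne β]
  | some b => cases b <;> simp [tagItems, expand, tagBlock_ne_nil]

theorem exists_lower_produce (x : Option Bool) : ∃ (q : List (Option Bool)) (y : Option Bool),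
    expand tr (tagItems β x) = q ++ [y] ∧
      TagRule.lower tr (.produce x) = fill β q ++ [some y] := by
  obtain h | ⟨q, y, h⟩ := List.eq_nil_or_concat' (expand tr (tagItems β x))
  · exact absurd h (expand_tagItems_ne_nil tr x)
  · exact ⟨q, y, h, by simp [TagRule.lower, h]⟩

theorem lower_flatMap_skip (s : List (Option Bool)) :
    (s.map TagRule.skip).flatMap (TagRule.lower tr) = List.replicate s.length none := by
  induction s with
  | nil => rfl
  | cons x s ih => simp [TagRule.lower, List.replicate_succ, ← ih]

theorem lower_flatMap_rules (G : List (TagMove β)) :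
    (G.flatMap TagMove.rules).flatMap (TagRule.lower tr) =
      fill β (expand tr (G.flatMap TagMove.items)) := by
  induction G with
  | nil => rfl
  | cons g G ih =>
    rw [List.flatMap_cons, List.flatMap_append, ih, List.flatMap_cons, expand_append, fill_append]
    congr 1
    cases g with
    | tag x s h =>
      obtain ⟨q, y, h1, h2⟩ := exists_lower_produce tr x
      have hs : s.length = β - 1 := by omega
      simp only [TagMove.rules, TagMove.items, List.flatMap_cons, h1, h2, lower_flatMap_skip,
        fill_append, fill_cons, hs]
      simp [fill]
    | shrink => simp [TagMove.rules, TagMove.items, TagRule.lower, expand_replicate_false]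

/-- If the lower words of some rules complete missing fillers then the rules start with letters
that are skipped. -/
theorem exists_skip_of_lower_eq {ρ : List TagRule} {k : ℕ} {z : List (Option Bool)}
    (h : ρ.flatMap (TagRule.lower tr) = List.replicate k none ++ fill β z) :
    ∃ (s : List (Option Bool)) (ρ' : List TagRule), s.length = k ∧ ρ = s.map .skip ++ ρ' ∧
      ρ'.flatMap (TagRule.lower tr) = fill β z := by
  induction k generalizing ρ with
  | zero => exact ⟨[], ρ, rfl, rfl, h⟩
  | succ k ih =>
    rcases ρ with _ | ⟨_ | _ | _, ρ⟩
    · simp [List.replicate_succ] at h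
    · rename_i x
      simp only [List.flatMap_cons, TagRule.lower, List.replicate_succ, List.cons_append,
        List.nil_append, List.cons.injEq, true_and] at h
      obtain ⟨s, ρ', rfl, rfl, h'⟩ := ih h
      exact ⟨x :: s, ρ', rfl, rfl, h'⟩
    · rename_i x
      obtain ⟨q, y, -, h2⟩ := exists_lower_produce tr x
      rw [List.flatMap_cons, h2] at h
      cases q <;> simp [fill, List.replicate_succ] at h
    · obtain ⟨b, hb⟩ := Nat.exists_eq_succ_of_ne_zero (NeZero.ne β)
      simp [List.flatMap_cons, TagRule.lower, hb, List.replicate_succ, fill_cons] at h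

/-- The fillers force the rules to come in groups that carry out moves of the tag system. -/
theorem exists_moves_of_lower_eq (ρ : List TagRule) {w z : List (Option Bool)}
    (h : fill β w ++ ρ.flatMap (TagRule.lower tr) = fill β z) :
    ∃ G : List (TagMove β), ρ = G.flatMap TagMove.rules := by
  induction hn : ρ.length using Nat.strong_induction_on generalizing ρ w z with
  | _ n ih =>
    subst hn
    rcases ρ with _ | ⟨_ | _ | _, ρ⟩
    · exact ⟨[], rfl⟩
    · obtain ⟨z', -, hz'⟩ := fill_append_eq_fill h
      cases z' <;> simp [fill, TagRule.lower] at hz'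
    · rename_i x
      obtain ⟨q, y, -, h2⟩ := exists_lower_produce tr x
      rw [List.flatMap_cons, h2, ← List.append_assoc, ← List.append_assoc, ← fill_append,
        List.append_assoc] at h
      obtain ⟨z', -, hz'⟩ := fill_append_eq_fill h
      rcases z' with _ | ⟨y', z'⟩
      · simp [fill] at hz'
      · rw [fill_cons, List.singleton_append, List.cons.injEq] at hz'
        obtain ⟨s, ρ', hs, rfl, h'⟩ := exists_skip_of_lower_eq tr hz'.2
        obtain ⟨G, rfl⟩ := ih ρ'.length (by
          simp) ρ' (w := []) (z := z') (by simpa [fill] using h')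
          rfl
        have := NeZero.pos β
        exact ⟨.tag x s (by omega) :: G, rfl⟩
    · obtain ⟨G, rfl⟩ := ih ρ.length (by simp) ρ (w := w ++ List.replicate β none)
        (z := z) (by rw [fill_append, List.append_assoc]; exact h) rfl
      exact ⟨.shrink :: G, rfl⟩

/-- The moves that empty the queue of the tag system are the solutions of the correspondence
problem: any solution splits into groups of rules that carry out moves. -/
theorem tagSolvable_iff (q : List (Option Bool)) :
    TagSolvable tr q ↔ ∃ ρ : List TagRule,
      ρ.flatMap (TagRule.upper β) = fill β q ++ ρ.flatMap (TagRule.lower tr) := by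
  constructor
  · rintro ⟨G, hG⟩
    refine ⟨G.flatMap TagMove.rules, ?_⟩
    rw [upper_flatMap_rules, lower_flatMap_rules, hG, fill_append]
  · rintro ⟨ρ, hρ⟩
    have hup : ∃ z, ρ.flatMap (TagRule.upper β) = fill β z := by
      clear hρ
      induction ρ with
      | nil => exact ⟨[], rfl⟩
      | cons r ρ ih =>
        obtain ⟨z, hz⟩ := ih
        rw [List.flatMap_cons, hz]
        cases r <;> exact ⟨_ ++ z, (fill_append _ _ _).symm⟩
    obtain ⟨z, hz⟩ := hup
    obtain ⟨G, rfl⟩ := exists_moves_of_lower_eq tr ρ (hρ.symm.trans hz)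
    rw [upper_flatMap_rules, lower_flatMap_rules, ← fill_append] at hρ
    exact ⟨G, fill_injective β hρ⟩

end

/-- A binary code of the symbols of the correspondence problem. -/
def symbolBits : Option (Option Bool) → List (Fin 2)
  | none => [0, 0]
  | some none => [0, 1]
  | some (some false) => [1, 0]
  | some (some true) => [1, 1]

theorem flatMap_symbolBits_injective :
    Function.Injective (List.flatMap symbolBits) := by
  intro u v h
  have inj : ∀ a b u v, symbolBits a ++ u = symbolBits b ++ v → a = b ∧ u = v := by
    rintro (_ | _ | _ | _) (_ | _ | _ | _) u v h <;> simp_all [symbolBits]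
  have ne : ∀ a u, symbolBits a ++ u ≠ [] := by
    rintro (_ | _ | _ | _) u h <;> simp [symbolBits] at h
  induction u generalizing v with
  | nil =>
    cases v with
    | nil => rfl
    | cons b v => exact absurd h.symm (ne b _)
  | cons a u ih =>
    cases v with
    | nil => exact absurd h (ne a _)
    | cons b v =>
      obtain ⟨rfl, h'⟩ := inj a b (u.flatMap symbolBits) (v.flatMap symbolBits) h
      rw [ih h']

/-- The correspondence problem with seven pairs of nonempty binary words and an additional last
pair is undecidable, even when only the last pair varies, in the exponent of one of its words. -/
theorem exists_correspondence_not_computablePred :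
    ∃ (g h : TagRule → List (Fin 2)) (_ : ∀ r, g r ≠ []) (_ : ∀ r, h r ≠ [])
      (s x v u : List (Fin 2)) (_ : s ≠ []) (_ : x ≠ []) (_ : v ≠ []) (_ : u ≠ []),
      ¬ ComputablePred fun n : ℕ => ∃ ρ : List TagRule,
        ρ.flatMap g ++ s = ρ.flatMap h ++ (x ++ ((List.replicate n v).flatten ++ u)) := by
  obtain ⟨β, hβ, tr, u, v, x, hv, hx, p, hp, hpn⟩ := exists_markMachine
  have : NeZero β := ⟨hβ⟩
  let bits : List Bool → List (Fin 2) := fun l => (fill β (expand tr l)).flatMap symbolBits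
  have bits_append : ∀ l l', bits (l ++ l') = bits l ++ bits l' := by
    intro l l'
    simp [bits, expand_append, fill_append]
  have bits_flatten : ∀ n, bits (List.replicate n v).flatten =
      (List.replicate n (bits v)).flatten := by
    intro n
    induction n with
    | zero => rfl
    | succ n ih => simp only [List.replicate_succ, List.flatten_cons, bits_append, ih]
  have bits_ne : ∀ l, l ≠ [] → bits l ≠ [] := by
    intro l hl hbits
    have h1 : fill β (expand tr l) = fill β [] := flatMap_symbolBits_injective hbits
    have h2 : expand tr l = [] := fill_injective β h1
    rcases l with _ | ⟨_ | _, l⟩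
    · exact hl rfl
    · simp [expand] at h2
    · simp [expand, tagBlock_ne_nil] at h2
  have upper_ne : ∀ r, TagRule.upper β r ≠ [] := by
    rintro (_ | _ | _) <;> simp [TagRule.upper, fill, NeZero.ne β]
  have lower_ne : ∀ r, TagRule.lower tr r ≠ [] := by
    rintro (_ | x | _)
    · simp [TagRule.lower]
    · obtain ⟨q, y, -, h⟩ := exists_lower_produce tr x
      simp [h]
    · simp [TagRule.lower, fill, NeZero.ne β]
  have symbols_ne : ∀ w : List (Option (Option Bool)), w ≠ [] →
      (w.flatMap symbolBits).reverse ≠ [] := by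
    intro w hw h
    exact hw (flatMap_symbolBits_injective (a₂ := []) (by simpa using h))
  -- All words are reversed, so that the initial queue becomes the last pair. A common first letter
  -- makes both of its words nonempty.
  refine ⟨fun r => ((TagRule.upper β r).flatMap symbolBits).reverse,
    fun r => ((TagRule.lower tr r).flatMap symbolBits).reverse,
    fun r => symbols_ne _ (upper_ne r), fun r => symbols_ne _ (lower_ne r),
    [0], (bits x).reverse, (bits v).reverse, (bits u).reverse ++ [0], by simp,
    by simpa using bits_ne x hx, by simpa using bits_ne v hv, by simp, ?_⟩
  have reverse_flatMap : ∀ (f : TagRule → List (Option (Option Bool))) (ρ : List TagRule),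
      ρ.flatMap (fun r => ((f r).flatMap symbolBits).reverse) =
        ((ρ.reverse.flatMap f).flatMap symbolBits).reverse := by
    intro f ρ
    induction ρ with
    | nil => rfl
    | cons r ρ ih => simp [ih]
  have hiff : ∀ n, p n ↔ ∃ ρ : List TagRule,
      ρ.flatMap (fun r => ((TagRule.upper β r).flatMap symbolBits).reverse) ++ [0] =
        ρ.flatMap (fun r => ((TagRule.lower tr r).flatMap symbolBits).reverse) ++
          ((bits x).reverse ++ ((List.replicate n (bits v).reverse).flatten ++
            ((bits u).reverse ++ [0]))) := by
    intro n
    obtain ⟨w, hw, h1, h2⟩ := hpn n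
    have h3 : p n ↔ TagSolvable tr (expand tr w) :=
      ⟨fun h => tagSolvable_of_reaches tr (h1 h), fun h => h2 (eval_dom_of_tagSolvable tr h)⟩
    have h4 : (bits x).reverse ++ ((List.replicate n (bits v).reverse).flatten ++
        ((bits u).reverse ++ [0])) = (bits w).reverse ++ [0] := by
      rw [hw, bits_append, bits_append, bits_flatten]
      simp [List.reverse_flatten]
    rw [h3, tagSolvable_iff, h4]
    constructor
    · rintro ⟨ρ, hρ⟩
      refine ⟨ρ.reverse, ?_⟩
      rw [reverse_flatMap, reverse_flatMap, List.reverse_reverse, hρ]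
      simp [bits]
    · rintro ⟨ρ, hρ⟩
      refine ⟨ρ.reverse, flatMap_symbolBits_injective ?_⟩
      rw [reverse_flatMap, reverse_flatMap, ← List.append_assoc, List.append_cancel_right_eq,
        ← List.reverse_append, List.reverse_inj] at hρ
      rw [hρ, List.flatMap_append]
  exact fun h => hp (h.of_eq fun n => (hiff n).symm)

end WeightedSync

namespace WeightedSync

/-! ### Words as elements of the semiring -/

section

variable {K : Type*} [Semiring K] (φ : FreeSemigroup (Fin 2) →ₙ* K)

/-- The value of a word of generators: the image of the word under `φ` if the word is nonempty, and
`1` for the empty word, which `FreeSemigroup` lacks. -/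
def wordValue (w : List (Fin 2)) : K :=
  (w.map fun x => φ (FreeSemigroup.of x)).prod

theorem wordValue_append (u v : List (Fin 2)) :
    wordValue φ (u ++ v) = wordValue φ u * wordValue φ v := by
  simp [wordValue]

theorem wordValue_cons (x : Fin 2) (l : List (Fin 2)) : wordValue φ (x :: l) = φ ⟨x, l⟩ := by
  induction l generalizing x with
  | nil => simp [wordValue, FreeSemigroup.of]
  | cons y l ih =>
    have h : (⟨x, y :: l⟩ : FreeSemigroup (Fin 2)) = FreeSemigroup.of x * ⟨y, l⟩ := rfl
    rw [h, map_mul, ← ih]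
    simp [wordValue]

variable {φ} (hφ : Function.Injective φ)
include hφ

theorem eq_of_wordValue_eq {u v : List (Fin 2)} (hu : u ≠ []) (hv : v ≠ [])
    (h : wordValue φ u = wordValue φ v) : u = v := by
  obtain ⟨x, u, rfl⟩ := List.exists_cons_of_ne_nil hu
  obtain ⟨y, v, rfl⟩ := List.exists_cons_of_ne_nil hv
  rw [wordValue_cons, wordValue_cons] at h
  have := hφ h
  simpa using this

theorem wordValue_ne_zero {u : List (Fin 2)} (hu : u ≠ []) : wordValue φ u ≠ 0 := by
  intro h
  have h1 : wordValue φ (u ++ u) = wordValue φ u := by rw [wordValue_append, h, zero_mul]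
  have h2 := congrArg List.length (eq_of_wordValue_eq hφ (by simp [hu]) hu h1)
  have := List.length_pos_of_ne_nil hu
  simp only [List.length_append] at h2
  omega

end

/-! ### Correspondence problems as families of deterministic matrices -/

section

variable {R : Type*} (g h : R → List (Fin 2)) (s y : List (Fin 2))

/-- The successor of a state under a letter: the letter `none` resets to state `0`, the others fix
the state. -/
def letterTarget : Option R → Fin 2 → Fin 2
  | none, _ => 0
  | some _, p => p

/-- The word that is the weight of the transition of a letter out of a state. State `0` collects the
first words of the pairs, state `1` the second ones; the last pair belongs to the reset. -/
def letterWord : Option R → Fin 2 → List (Fin 2)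
  | none, p => if p = 0 then s else y
  | some r, p => if p = 0 then g r else h r

/-- The state reached from a state along a word of letters. -/
def pathTarget (w : List (Option R)) (p : Fin 2) : Fin 2 :=
  w.foldl (fun q a => letterTarget a q) p

/-- The weight collected from a state along a word of letters. -/
def pathWord : List (Option R) → Fin 2 → List (Fin 2)
  | [], _ => []
  | a :: w, p => letterWord g h s y a p ++ pathWord w (letterTarget a p)

theorem pathWord_map_some_append (ρ : List R) (w : List (Option R)) (p : Fin 2) :
    pathWord g h s y (ρ.map some ++ none :: w) p =
      ρ.flatMap (if p = 0 then g else h) ++ (if p = 0 then s else y) ++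
        pathWord g h s y w 0 := by
  induction ρ with
  | nil => simp [pathWord, letterWord, letterTarget]
  | cons r ρ ih =>
    simp only [List.map_cons, List.cons_append, pathWord, letterTarget, ih, List.flatMap_cons,
      letterWord]
    split <;> simp

theorem pathTarget_map_some_append (ρ : List R) (w : List (Option R)) (p q : Fin 2) :
    pathTarget (ρ.map some ++ none :: w) p = pathTarget (ρ.map some ++ none :: w) q := by
  induction ρ with
  | nil => rfl
  | cons r ρ ih => exact ih

/-- Two states can only be merged by a reset. -/
theorem exists_eq_map_some_append {w : List (Option R)} (hw : pathTarget w 0 = pathTarget w 1) :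
    ∃ (ρ : List R) (w' : List (Option R)), w = ρ.map some ++ none :: w' := by
  induction w with
  | nil => exact absurd (show (0 : Fin 2) = 1 from hw) (by decide)
  | cons a w ih =>
    cases a with
    | none => exact ⟨[], w, rfl⟩
    | some r =>
      obtain ⟨ρ, w', rfl⟩ := ih hw
      exact ⟨r :: ρ, w', rfl⟩

variable {K : Type*} [Semiring K] (φ : FreeSemigroup (Fin 2) →ₙ* K)

/-- The transition matrix of a letter, whose weights are the values of the words `letterWord`; one
row for each state. -/
def letterMatrix (a : Option R) : Matrix (Fin 2) (Fin 2) K :=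
  Matrix.of fun p q => if q = letterTarget a p then wordValue φ (letterWord g h s y a p) else 0

theorem prod_letterMatrix (w : List (Option R)) :
    (w.map (letterMatrix g h s y φ)).prod =
      Matrix.of fun p q =>
        if q = pathTarget w p then wordValue φ (pathWord g h s y w p) else 0 := by
  induction w with
  | nil =>
    ext p q
    simp [Matrix.one_apply, pathTarget, pathWord, wordValue, eq_comm]
  | cons a w ih =>
    ext p q
    rw [List.map_cons, List.prod_cons, ih]
    have h1 : pathTarget (a :: w) p = pathTarget w (letterTarget a p) := rfl
    simp only [Matrix.mul_apply, letterMatrix, h1, pathWord, wordValue_append, Matrix.of_apply,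
      ite_mul, zero_mul, Finset.sum_ite_eq', Finset.mem_univ, if_true]
    simp only [mul_ite, mul_zero]

variable {g h s y φ}
variable (hg : ∀ r, g r ≠ []) (hh : ∀ r, h r ≠ []) (hs : s ≠ []) (hy : y ≠ [])
include hg hh hs hy

theorem letterWord_ne_nil (a : Option R) (p : Fin 2) : letterWord g h s y a p ≠ [] := by
  cases a <;> simp only [letterWord] <;> split <;> simp_all

variable (hφ : Function.Injective φ)
include hφ

theorem isSynchronizing_prod_letterMatrix_iff {w : List (Option R)} (hw : w ≠ []) :
    IsSynchronizing (w.map (letterMatrix g h s y φ)).prod ↔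
      pathTarget w 0 = pathTarget w 1 ∧ pathWord g h s y w 0 = pathWord g h s y w 1 := by
  have ne : ∀ p, pathWord g h s y w p ≠ [] := by
    intro p
    obtain ⟨a, w, rfl⟩ := List.exists_cons_of_ne_nil hw
    simp [pathWord, letterWord_ne_nil hg hh hs hy]
  have hz : ∀ p, wordValue φ (pathWord g h s y w p) ≠ 0 := fun p => wordValue_ne_zero hφ (ne p)
  rw [prod_letterMatrix]
  constructor
  · rintro ⟨i, h1, h2⟩
    have h3 : ∀ p, i = pathTarget w p := by
      intro p
      have := (h1 p i).2 rfl
      by_contra hc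
      simp [hc] at this
    have h4 := h2 0 1
    simp only [Matrix.of_apply, ← h3, if_true] at h4
    exact ⟨(h3 0).symm.trans (h3 1), eq_of_wordValue_eq hφ (ne 0) (ne 1) h4⟩
  · rintro ⟨h1, h2⟩
    have h3 : ∀ p, pathTarget w p = pathTarget w 0 := by
      intro p; fin_cases p
      exacts [rfl, h1.symm]
    have h4 : ∀ p, pathWord g h s y w p = pathWord g h s y w 0 := by
      intro p; fin_cases p
      exacts [rfl, h2.symm]
    refine ⟨pathTarget w 0, fun j k => ?_, fun j j' => ?_⟩
    · simp [h3 j, hz]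
    · simp [h3 j, h3 j', h4 j, h4 j']

/-- The matrices are synchronizable if and only if the correspondence problem is solvable: a reset
is needed to merge the states, and what is collected after the first reset is the same in both
rows. -/
theorem synchronizable_letterMatrix_iff :
    Synchronizable (letterMatrix g h s y φ) ↔
      ∃ ρ : List R, ρ.flatMap g ++ s = ρ.flatMap h ++ y := by
  constructor
  · rintro ⟨w, hw, hs'⟩
    obtain ⟨h1, h2⟩ := (isSynchronizing_prod_letterMatrix_iff hg hh hs hy hφ hw).1 hs'
    obtain ⟨ρ, w', rfl⟩ := exists_eq_map_some_append h1
    refine ⟨ρ, ?_⟩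
    simpa [pathWord_map_some_append, ← List.append_assoc] using h2
  · rintro ⟨ρ, hρ⟩
    refine ⟨ρ.map some ++ [none], by simp, ?_⟩
    rw [isSynchronizing_prod_letterMatrix_iff hg hh hs hy hφ (by simp)]
    refine ⟨pathTarget_map_some_append ρ [] 0 1, ?_⟩
    simpa [pathWord_map_some_append, pathWord] using hρ

theorem exists_isDeterministic_trans_eq {A : Type*} (e : A → Option R) :
    ∃ M : WeightedAutomaton K A 2,
      M.IsDeterministic ∧ M.trans = fun i => letterMatrix g h s y φ (e i) := by
  have hne : ∀ a p q, letterMatrix g h s y φ a p q ≠ 0 ↔ q = letterTarget a p := by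
    intro a p q
    simp [letterMatrix, wordValue_ne_zero hφ (letterWord_ne_nil hg hh hs hy a p)]
  refine ⟨⟨Pi.single 0 (wordValue φ s), fun i => letterMatrix g h s y φ (e i), 0⟩,
    ⟨⟨fun a p q q' hq hq' => ?_, 0, ?_, fun p hp => ?_⟩, fun a p => ⟨letterTarget (e a) p, ?_,
      fun q hq => ?_⟩⟩, rfl⟩
  · rw [(hne _ _ _).1 hq, (hne _ _ _).1 hq']
  · simpa using wordValue_ne_zero hφ hs
  · by_contra hc
    exact hp (by simp [hc])
  · exact (hne _ _ _).2 rfl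
  · exact (hne _ _ _).1 hq

end

theorem synchronizable_comp_equiv_iff {K A B : Type*} [Semiring K] {n : ℕ} (e : A ≃ B)
    (M : B → Matrix (Fin n) (Fin n) K) :
    Synchronizable (fun i => M (e i)) ↔ Synchronizable M := by
  constructor
  · rintro ⟨w, hw, h⟩
    exact ⟨w.map e, by simpa using hw, by simpa [Function.comp_def] using h⟩
  · rintro ⟨w, hw, h⟩
    exact ⟨w.map e.symm, by simpa using hw, by simpa [Function.comp_def] using h⟩

end WeightedSync

namespace WeightedSync

/-! ### Computing names of the entries -/

section

variable {K : Type*} [Semiring K] {φ : FreeSemigroup (Fin 2) →ₙ* K} {ν : ℕ →. K}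

theorem exists_name_wordValue (hmul : MulComputable ν)
    (hgen : ∀ x : Fin 2, ∃ c, φ (FreeSemigroup.of x) ∈ ν c) {w : List (Fin 2)} (hw : w ≠ []) :
    ∃ c, wordValue φ w ∈ ν c := by
  obtain ⟨m, -, hm⟩ := hmul
  have hgen' : ∀ x : Fin 2, ∃ c, wordValue φ [x] ∈ ν c := by simpa [wordValue] using hgen
  induction w with
  | nil => exact absurd rfl hw
  | cons x w ih =>
    by_cases hw' : w = []
    · subst hw'
      exact hgen' x
    · obtain ⟨c, hc⟩ := hgen' x
      obtain ⟨d, hd⟩ := ih hw'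
      obtain ⟨e, -, he⟩ := hm c d _ _ hc hd
      rw [← wordValue_append] at he
      exact ⟨e, he⟩

/-- Names of the values of the words `x vⁿ u` can be computed from `n`. -/
theorem exists_computable_name_wordValue (hmul : MulComputable ν)
    (hgen : ∀ x : Fin 2, ∃ c, φ (FreeSemigroup.of x) ∈ ν c) {x v u : List (Fin 2)}
    (hx : x ≠ []) (hv : v ≠ []) (hu : u ≠ []) :
    ∃ N : ℕ → ℕ, Computable N ∧
      ∀ n, wordValue φ (x ++ ((List.replicate n v).flatten ++ u)) ∈ ν (N n) := by
  obtain ⟨cx, hcx⟩ := exists_name_wordValue hmul hgen hx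
  obtain ⟨cv, hcv⟩ := exists_name_wordValue hmul hgen hv
  obtain ⟨cu, hcu⟩ := exists_name_wordValue hmul hgen hu
  obtain ⟨m, hm, hmν⟩ := hmul
  let F : ℕ →. ℕ := fun n => Nat.rec (Part.some cu) (fun _ ih => ih.bind fun e => m cv e) n
  have hF : Partrec F :=
    Partrec.nat_rec (f := fun n : ℕ => n) (g := fun _ => Part.some cu)
      (h := fun _ p => m cv p.2) Computable.id (Computable.const cu)
      (hm.comp (Computable.const cv) (Computable.snd.comp Computable.snd)).to₂
  have hFν : ∀ n, ∃ e ∈ F n, wordValue φ ((List.replicate n v).flatten ++ u) ∈ ν e := by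
    intro n
    induction n with
    | zero => exact ⟨cu, Part.mem_some cu, hcu⟩
    | succ n ih =>
      obtain ⟨e, he, heν⟩ := ih
      obtain ⟨d, hd, hdν⟩ := hmν cv e _ _ hcv heν
      refine ⟨d, Part.mem_bind he hd, ?_⟩
      rwa [List.replicate_succ, List.flatten_cons, List.append_assoc, wordValue_append]
  have hG : ∀ n, ∃ d ∈ (F n).bind fun e => m cx e,
      wordValue φ (x ++ ((List.replicate n v).flatten ++ u)) ∈ ν d := by
    intro n
    obtain ⟨e, he, heν⟩ := hFν n
    obtain ⟨d, hd, hdν⟩ := hmν cx e _ _ hcx heν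
    exact ⟨d, Part.mem_bind he hd, by rwa [wordValue_append]⟩
  choose N hN hNν using hG
  exact ⟨N, (hF.bind (hm.comp (Computable.const cx) Computable.snd).to₂).of_eq_tot hN, hNν⟩

end

/-- An algorithm for the synchronizability problem decides every property of numbers that reduces
to it by families of matrices with computable descriptions. -/
theorem SyncDecidableOn.computablePred {K : Type*} [Semiring K] {ν : ℕ →. K}
    {C : ∀ k n : ℕ, (Fin k → Matrix (Fin n) (Fin n) K) → Prop} (hC : SyncDecidableOn ν C)
    {k s : ℕ} (hs : 0 < s) {M : ℕ → Fin k → Matrix (Fin s) (Fin s) K} (hM : ∀ n, C k s (M n))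
    (hν : ∀ i p q, ∃ c : ℕ → ℕ, Computable c ∧ ∀ n, M n i p q ∈ ν (c n)) :
    ComputablePred fun n => Synchronizable (M n) := by
  classical
  obtain ⟨f, hf, hfM⟩ := hC
  choose c hc hcM using hν
  let l : ℕ → List (List (List ℕ)) := fun n =>
    List.ofFn fun i => List.ofFn fun p => List.ofFn fun q => c i p q n
  have hl : Computable l :=
    Computable.list_ofFn fun i => Computable.list_ofFn fun p => Computable.list_ofFn fun q =>
      hc i p q
  refine ⟨Classical.decPred _, (hf.comp hl).of_eq_tot fun n => ?_⟩
  obtain ⟨b, hb, hbM⟩ := hfM k s (M n) hs (hM n) (l n)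
    ⟨fun i p q => c i p q n, rfl, fun i p q => hcM i p q n⟩
  have : decide (Synchronizable (M n)) = b := by
    rw [Bool.eq_iff_iff, decide_eq_true_iff, hbM]
  rwa [this]

theorem SyncDecidableOn.mono {K : Type*} [Semiring K] {ν : ℕ →. K}
    {C D : ∀ k n : ℕ, (Fin k → Matrix (Fin n) (Fin n) K) → Prop} (hD : SyncDecidableOn ν D)
    (hCD : ∀ k n M, C k n M → D k n M) : SyncDecidableOn ν C := by
  obtain ⟨f, hf, h⟩ := hD
  exact ⟨f, hf, fun k n M hn hC => h k n M hn (hCD k n M hC)⟩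

end WeightedSync

theorem mainTheorem2 {K : Type*} [Semiring K]
    (φ : FreeSemigroup (Fin 2) →ₙ* K) (hφ : Function.Injective φ)
    (ν : ℕ →. K) (hmul : WeightedSync.MulComputable ν)
    (hzero : ∃ c, (0 : K) ∈ ν c)
    (hgen : ∀ x : Fin 2, ∃ c, φ (FreeSemigroup.of x) ∈ ν c) :
    ¬ WeightedSync.SyncDecidableOn ν (WeightedSync.AllInstances K) ∧
    ¬ WeightedSync.SyncDecidableOn ν (WeightedSync.DeterministicInstances K 8 2) := by
  open WeightedSync in
  suffices h : ¬ SyncDecidableOn ν (DeterministicInstances K 8 2) from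
    ⟨fun hall => h (hall.mono fun _ _ _ _ => trivial), h⟩
  intro hdec
  obtain ⟨g, h, hg, hh, s, x, v, u, hs, hx, hv, hu, hp⟩ :=
    exists_correspondence_not_computablePred
  have e : Fin 8 ≃ Option TagRule :=
    (Fintype.equivFinOfCardEq (by rw [Fintype.card_option, card_tagRule])).symm
  have hy : ∀ n, x ++ ((List.replicate n v).flatten ++ u) ≠ [] := by simp [hx]
  let M : ℕ → Fin 8 → Matrix (Fin 2) (Fin 2) K := fun n i =>
    letterMatrix g h s (x ++ ((List.replicate n v).flatten ++ u)) φ (e i)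
  have hM : ComputablePred fun n => Synchronizable (M n) := by
    refine hdec.computablePred two_pos
      (fun n => ⟨rfl, rfl, exists_isDeterministic_trans_eq hg hh hs (hy n) hφ e⟩)
      fun i p q => ?_
    -- Only the entry that holds the value of the varying word depends on `n`.
    have hword : ∃ c : ℕ → ℕ, Computable c ∧ ∀ n, wordValue φ
        (letterWord g h s (x ++ ((List.replicate n v).flatten ++ u)) (e i) p) ∈ ν (c n) := by
      have const : ∀ {w : List (Fin 2)}, w ≠ [] →
          ∃ c : ℕ → ℕ, Computable c ∧ ∀ n, wordValue φ w ∈ ν (c n) := fun hw =>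
        let ⟨c, hc⟩ := exists_name_wordValue hmul hgen hw
        ⟨fun _ => c, Computable.const c, fun _ => hc⟩
      cases e i with
      | none =>
        by_cases hp0 : p = 0
        · simpa [letterWord, hp0] using const hs
        · simpa [letterWord, hp0] using exists_computable_name_wordValue hmul hgen hx hv hu
      | some r =>
        by_cases hp0 : p = 0
        · simpa [letterWord, hp0] using const (hg r)
        · simpa [letterWord, hp0] using const (hh r)
    by_cases hq : q = letterTarget (e i) p
    · simpa [M, letterMatrix, hq] using hword
    · obtain ⟨c, hc⟩ := hzero
      exact ⟨fun _ => c, Computable.const c, fun n => by simpa [M, letterMatrix, hq] using hc⟩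
  exact hp (hM.of_eq fun n => (synchronizable_comp_equiv_iff e _).trans
    (synchronizable_letterMatrix_iff hg hh hs (hy n) hφ))
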